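/- **Setting.** Let $0<S\le M$, $\mathcal Q=\mathbb R^M$, and let the controls take values in $\mathbb R^S$. Consider the problem of minimising $\phi(q(T),\dot q(T))+\int_0^T\tfrac12u^\top \mathrm g(q)u\,dt$ subject to $\ddot q=f(q,\dot q)+\rho(q)u$, $q(0)=q^0$, $\dot q(0)=\dot q^0$, where $T>0$, $\rho(q):\mathbb R^S\to\mathbb R^M$ is linear and injective, $\mathrm g=\rho^*\mathrm g_{\mathcal Q}$ for a Riemannian metric $\mathrm g_{\mathcal Q}$ on $\mathbb R^M$, and $f,\rho,\mathrm g_{\mathcal Q},\phi$ are $C^4$. For $y=(q,\lambda)$ put $$\tilde{\mathcal L}(y,\dot y,u)=\dot\lambda^\top\dot q+\lambda^\top\big(f(q,\dot q)+\rho(q)u\big)-\tfrac12u^\top \mathrm g(q)u .$$ A *trajectory* is a pair $(y,u)$ on $[0,T]$, with $y\in C^4$, $u\in C^2$, satisfying under the (not necessarily optimal) control $u$ the state equation and the adjoint equation $$\ddot\lambda=\Big(\tfrac{\partial f}{\partial q}+\tfrac{\partial \rho}{\partial q}u\Big)^{\!\top}\lambda-\tfrac{d}{dt}\Big(\big(\tfrac{\partial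 f}{\partial\dot q}\big)^{\!\top}\lambda\Big)-\tfrac12\Big(\tfrac{\partial \mathrm g}{\partial q}(u,u)\Big)^{\!\top}.$$ **Exact discrete Lagrangian.** Let $N\ge1$, $h=T/N$, $t_k=kh$. Near the end points of a trajectory on $[t_k,t_{k+1}]$, the exact semi-discrete Lagrangian is $L^e_k(a,b)=\int_{t_k}^{t_{k+1}}\tilde{\mathcal L}(Y,\dot Y,u)\,dt$, where $Y=Y_{a,b}$ solves the state and adjoint equations under $u$ with $Y(t_k)=a$, $Y(t_{k+1})=b$, and is a $C^2$ family in $(a,b,t)$ that contains the given trajectory. As usual it is assumed to be well defined: the estimates below are asserted for those grids on which it exists, and for every such family. Its control variation is $D_3L^e_k[\delta u]=\int_{t_k}^{t_{k+1}}\partial_u\tilde{\mathcal L}(y,\dot y,u)\,\delta u\,dt$. **The scheme.** For $\alpha,\beta,\gamma\in[0,1]$ put $$L_k(a,b,U^{(1)},U^{(2)})=h\Big[\alpha\,\tilde{\mathcal L}\big(\gamma a+(1-\gamma)b,\tfrac{b-a}h,U^{(1)}\big)+(1-\alpha)\,\tilde{\mathcal L}\big((1-\gamma)a+\gamma b,\tfrac{b-a}h,U^{(2)}\big)\Big],$$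 where $U^{(1)}$, $U^{(2)}$ and their variations stand for the values of $u$ and $\delta u$ at $\beta t_k+(1-\beta)t_{k+1}$ and $(1-\beta)t_k+\beta t_{k+1}$ respectively, so that $D_3L_k[\delta u]$ is the derivative of $L_k$ in $(U^{(1)},U^{(2)})$ in the direction of these two values of $\delta u$. **Optimality conditions.** For discrete Lagrangians $L_0,\dots,L_{N-1}$ (exact or approximate), with the discrete velocities $v_0^-=-D_{\lambda_0}L_0$ and $v_N^+=D_{\lambda_N}L_{N-1}$, the discrete optimality conditions, with the conditions $\lambda_0=\nu$ and $\lambda_N^\top=-D_2\phi$ appended, are $$D_1L_k+D_2L_{k-1}=0\ (1\le k\le N-1),\qquad D_3L_k[\delta u]=0\ (0\le k\le N-1),$$ $$\mu^\top-D_{q_0}L_0=0,\quad D_1\phi(q_N,v_N^+)-D_{q_N}L_{N-1}=0,\quad q_0-q^0=0,\quad v_0^--\dot q^0=0,\quad\lambda_0-\nu=0,\quad\lambda_N^\top+D_2\phi(q_N,v_N^+)=0 .$$ **Orders of approximation.** * The *discrete Lagrangian is approximated to order $r$* along a trajectory if there is a constant $C$ with $|L_k-L^e_k|\le Ch^{r+1}$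 at the samples $y(t_k),y(t_{k+1})$, for all $N\ge1$ and $0\le k<N$. * The *optimality conditions are approximated to order $r$* along a trajectory (with multipliers $\mu,\nu$) if for every $\delta u\in C^2$ there is a constant $C$ such that, for all $N\ge1$ and at the samples $y_k=y(t_k)$, the left-hand sides of the conditions of the scheme and of the exact ones differ by at most $Ch^{r+1}$ for the first two families (which are $h$ times a differential, respectively pointwise, condition) and by at most $Ch^r$ for all the others. **Proposition.** Let $0<S\le M$ and $\alpha,\beta,\gamma\in[0,1]$. 1. If $\alpha=\tfrac12$ (any $\beta,\gamma$) or $\beta=\gamma=\tfrac12$ (any $\alpha$), then for every problem and every trajectory the discrete Lagrangian is approximated to order $2$, and for all multipliers $\mu,\nu$ the optimality conditions are approximated to order $2$. 2. For all other $\alpha,\beta,\gamma$ both are approximated to order $1$ for every problem, every trajectory and all multipliers, and in general not to order $2$: there are a problem and a trajectory along which the discrete Lagrangian is not approximated to order $2$; and there are a problem, a trajectory and multipliers $\mu,\nu$ that solve the exact discrete optimality conditions on every grid ($N\ge1$), for which the optimality conditions are not approximated to order $2$. -/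

import Mathlib

open Set
open scoped RealInnerProductSpace

noncomputable section

/-- The configuration space `ℝ^M`. -/
abbrev Conf (M : ℕ) := EuclideanSpace ℝ (Fin M)

/-- The control space `ℝ^S`. -/
abbrev Ctrl (S : ℕ) := EuclideanSpace ℝ (Fin S)

/-- State-adjoint pairs `y = (q, lam)`; covectors are identified with vectors by the Euclidean
inner product, so that the pairing of `lam` and `x` is `⟪lam, x⟫`. -/
abbrev Phase (M : ℕ) := Conf M × Conf M

/-- The data of the optimal control problem: minimise
`φ (q T) (q' T) + ∫ 1/2 g(q)(u,u)` subject to `q'' = f(q,q') + ρ(q) u`, `q 0 = qInit`,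
`q' 0 = vInit`. Here `ρ` is an injective anchor and `g` is the pull-back by `ρ` of the
Riemannian metric `gQ`. -/
structure ControlProblem (M S : ℕ) where
  f : Conf M → Conf M → Conf M
  ρ : Conf M → Ctrl S →L[ℝ] Conf M
  gQ : Conf M → Conf M →L[ℝ] Conf M →L[ℝ] ℝ
  φ : Conf M → Conf M → ℝ
  qInit : Conf M
  vInit : Conf M
  T : ℝ
  T_pos : 0 < T
  f_smooth : ContDiff ℝ 4 (fun x : Conf M × Conf M => f x.1 x.2)
  ρ_smooth : ContDiff ℝ 4 ρ
  gQ_smooth : ContDiff ℝ 4 gQ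
  φ_smooth : ContDiff ℝ 4 (fun x : Conf M × Conf M => φ x.1 x.2)
  ρ_injective : ∀ q, Function.Injective (ρ q)
  gQ_symm : ∀ q v w, gQ q v w = gQ q w v
  gQ_pos : ∀ q v, v ≠ 0 → 0 < gQ q v v

namespace ControlProblem

variable {M S : ℕ} (P : ControlProblem M S)

/-- The metric on the controls, `g = ρ^* gQ`. -/
def g (q : Conf M) (u w : Ctrl S) : ℝ := P.gQ q (P.ρ q u) (P.ρ q w)

/-- The control-dependent Lagrangian
`vLam^T v + lam^T (f(q,v) + ρ(q) u) - 1/2 u^T g(q) u`, with `y = (q, lam)`, `w = (v, vLam)`. -/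
def lagrangian (y w : Phase M) (u : Ctrl S) : ℝ :=
  ⟪w.2, w.1⟫ + ⟪y.2, P.f y.1 w.1 + P.ρ y.1 u⟫ - 1 / 2 * P.g y.1 u u

/-- `y = (q, lam)` satisfies the state dynamics and the adjoint dynamics on `[a, b]` under the
control `u`; the adjoint equation is paired with an arbitrary vector `w`. -/
def SolvesOn (u : ℝ → Ctrl S) (y : ℝ → Phase M) (a b : ℝ) : Prop :=
  ∀ t ∈ Icc a b,
    (deriv (deriv y) t).1 = P.f (y t).1 (deriv y t).1 + P.ρ (y t).1 (u t) ∧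
    ∀ w : Conf M,
      ⟪(deriv (deriv y) t).2, w⟫ =
        ⟪(y t).2, fderiv ℝ (fun q => P.f q (deriv y t).1) (y t).1 w
            + fderiv ℝ P.ρ (y t).1 w (u t)⟫
          - deriv (fun s => ⟪(y s).2, fderiv ℝ (fun v => P.f (y s).1 v) (deriv y s).1 w⟫) t
          - 1 / 2 * fderiv ℝ (fun q => P.g q (u t) (u t)) (y t).1 w

/-- A sufficiently differentiable state-adjoint trajectory on `[0, T]` under an arbitrary (not
necessarily optimal) control. Differentiability on the closed interval is expressed by taking
the curves to be defined on all of `ℝ`; only their restriction to `[0, T]` matters. -/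
structure Trajectory where
  y : ℝ → Phase M
  u : ℝ → Ctrl S
  y_smooth : ContDiff ℝ 4 y
  u_smooth : ContDiff ℝ 2 u
  solves : P.SolvesOn u y 0 P.T

/-- `Ld` is, near `(y a, y b)`, the exact (semi-)discrete Lagrangian for the control `u` on the
time interval `[a, b]`: there is a `C^2` family `Y` of solutions of the two-point boundary value
problems with end points `z.1`, `z.2` close to `y a`, `y b`, which contains `y` itself, and
`Ld z.1 z.2` is the integral of the Lagrangian along `Y z`. -/
def IsExactDiscreteLagrangian (u : ℝ → Ctrl S) (y : ℝ → Phase M) (a b : ℝ)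
    (Ld : Phase M → Phase M → ℝ) : Prop :=
  ∃ (V : Set (Phase M × Phase M)) (Y : Phase M × Phase M → ℝ → Phase M),
    IsOpen V ∧ (y a, y b) ∈ V ∧
    ContDiffOn ℝ 2 (fun p : (Phase M × Phase M) × ℝ => Y p.1 p.2) (V ×ˢ univ) ∧
    (∀ s ∈ Icc a b, Y (y a, y b) s = y s) ∧
    ∀ z ∈ V, Y z a = z.1 ∧ Y z b = z.2 ∧ P.SolvesOn u (Y z) a b ∧
      Ld z.1 z.2 = ∫ s in a..b, P.lagrangian (Y z s) (deriv (Y z) s) (u s)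

/-- The low-order discrete Lagrangian with parameters `α`, `γ`, step `h` and control values
`U.1`, `U.2`. -/
def approxLagrangian (α γ h : ℝ) (y₀ y₁ : Phase M) (U : Ctrl S × Ctrl S) : ℝ :=
  h * (α * P.lagrangian (γ • y₀ + (1 - γ) • y₁) (h⁻¹ • (y₁ - y₀)) U.1
    + (1 - α) * P.lagrangian ((1 - γ) • y₀ + γ • y₁) (h⁻¹ • (y₁ - y₀)) U.2)

end ControlProblem

section DiscreteOptimality

variable {M S : ℕ}

/-- Derivative of a discrete Lagrangian in its first argument. -/
def discD₁ (L : Phase M → Phase M → ℝ) (a b : Phase M) : Phase M →L[ℝ] ℝ :=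
  fderiv ℝ (fun a' => L a' b) a

/-- Derivative of a discrete Lagrangian in its second argument. -/
def discD₂ (L : Phase M → Phase M → ℝ) (a b : Phase M) : Phase M →L[ℝ] ℝ :=
  fderiv ℝ (fun b' => L a b') b

/-- The discrete velocity at the left end, minus the derivative in the left adjoint. -/
def velMinus (L : Phase M → Phase M → ℝ) (a b : Phase M) : Conf M :=
  - gradient (fun l => L (a.1, l) b) a.2

/-- The discrete velocity at the right end, the derivative in the right adjoint. -/
def velPlus (L : Phase M → Phase M → ℝ) (a b : Phase M) : Conf M :=
  gradient (fun l => L a (b.1, l)) b.2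

/-- The left-hand sides of a system of discrete optimality conditions, each of which reads
`left-hand side = 0`. -/
structure OptimalityLHS (M S : ℕ) where
  /-- variation of `y_k`, `k = 1, ..., N - 1` -/
  dy : ℕ → Phase M →L[ℝ] ℝ
  /-- variation of the control on the `k`-th interval, `k = 0, ..., N - 1` -/
  du : ℕ → (ℝ → Ctrl S) → ℝ
  dq₀ : Conf M →L[ℝ] ℝ
  dqN : Conf M →L[ℝ] ℝ
  dμ : Conf M
  dν : Conf M
  dv₀ : Conf M
  dvN : Conf M →L[ℝ] ℝ

/-- The discrete optimality conditions built from discrete Lagrangians `L k` on the intervals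
`k = 0, ..., N - 1` and their control variations `D₃ k`, with the conditions `lam_0 = ν` and
`lam_N = - D₂ φ` appended (so the terms with the factors `ν - lam_0` and `lam_N + D₂ φ` are
absent from the other conditions). -/
def optimalityLHS (P : ControlProblem M S) (N : ℕ) (y : ℕ → Phase M) (μ ν : Conf M)
    (L : ℕ → Phase M → Phase M → ℝ) (D₃ : ℕ → (ℝ → Ctrl S) → ℝ) : OptimalityLHS M S where
  dy k := discD₁ (L k) (y k) (y (k + 1)) + discD₂ (L (k - 1)) (y (k - 1)) (y k)
  du k δu := D₃ k δu
  dq₀ := innerSL ℝ μ - (discD₁ (L 0) (y 0) (y 1)).comp (ContinuousLinearMap.inl ℝ _ _)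
  dqN := fderiv ℝ (fun q => P.φ q (velPlus (L (N - 1)) (y (N - 1)) (y N))) (y N).1
    - (discD₂ (L (N - 1)) (y (N - 1)) (y N)).comp (ContinuousLinearMap.inl ℝ _ _)
  dμ := (y 0).1 - P.qInit
  dν := velMinus (L 0) (y 0) (y 1) - P.vInit
  dv₀ := (y 0).2 - ν
  dvN := innerSL ℝ (y N).2
    + fderiv ℝ (fun v => P.φ (y N).1 v) (velPlus (L (N - 1)) (y (N - 1)) (y N))

end DiscreteOptimality

namespace ControlProblem

variable {M S : ℕ} (P : ControlProblem M S)

/-- The step size of the grid with `N` intervals. -/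
def step (N : ℕ) : ℝ := P.T / N

/-- The grid point `t_k = k h`. -/
def grid (N k : ℕ) : ℝ := k * P.step N

/-- The intermediate time `β t_k + (1 - β) t_{k+1}`. -/
def midTime (N : ℕ) (β : ℝ) (k : ℕ) : ℝ := β * P.grid N k + (1 - β) * P.grid N (k + 1)

/-- The values at the two intermediate times of the `k`-th interval of a curve in the control
space. -/
def sample (N : ℕ) (β : ℝ) (k : ℕ) (w : ℝ → Ctrl S) : Ctrl S × Ctrl S :=
  (w (P.midTime N β k), w (P.midTime N (1 - β) k))

/-- `L k` is the exact discrete Lagrangian on the `k`-th interval, for all `k < N`. -/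
def IsExactFamily (X : P.Trajectory) (N : ℕ) (L : ℕ → Phase M → Phase M → ℝ) : Prop :=
  ∀ k < N, P.IsExactDiscreteLagrangian X.u X.y (P.grid N k) (P.grid N (k + 1)) (L k)

/-- The exact discrete optimality conditions at the samples of the trajectory. -/
def exactLHS (X : P.Trajectory) (μ ν : Conf M) (N : ℕ) (L : ℕ → Phase M → Phase M → ℝ) :
    OptimalityLHS M S :=
  optimalityLHS P N (fun k => X.y (P.grid N k)) μ ν L
    (fun k δu => ∫ s in (P.grid N k)..(P.grid N (k + 1)),
      fderiv ℝ (fun w => P.lagrangian (X.y s) (deriv X.y s) w) (X.u s) (δu s))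

/-- The optimality conditions of the low-order scheme at the samples of the trajectory, with
`U_k^(1)`, `U_k^(2)` and their variations the values of `u` and `δu` at the times
`β t_k + (1 - β) t_{k+1}` and `(1 - β) t_k + β t_{k+1}`. -/
def approxLHS (X : P.Trajectory) (μ ν : Conf M) (α β γ : ℝ) (N : ℕ) : OptimalityLHS M S :=
  optimalityLHS P N (fun k => X.y (P.grid N k)) μ ν
    (fun k a b => P.approxLagrangian α γ (P.step N) a b (P.sample N β k X.u))
    (fun k δu => fderiv ℝ
      (fun U => P.approxLagrangian α γ (P.step N)
        (X.y (P.grid N k)) (X.y (P.grid N (k + 1))) U)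
      (P.sample N β k X.u) (P.sample N β k δu))

/-- Along `X`, the discrete Lagrangian of the scheme approximates the exact one to order `r`. -/
def LagrangianOrder (X : P.Trajectory) (α β γ : ℝ) (r : ℕ) : Prop :=
  ∃ C : ℝ, ∀ N : ℕ, 0 < N → ∀ L, P.IsExactFamily X N L → ∀ k < N,
    |P.approxLagrangian α γ (P.step N) (X.y (P.grid N k)) (X.y (P.grid N (k + 1)))
        (P.sample N β k X.u)
      - L k (X.y (P.grid N k)) (X.y (P.grid N (k + 1)))| ≤ C * P.step N ^ (r + 1)

/-- Along `X`, the optimality conditions of the scheme approximate the exact discrete ones to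
order `r`. The conditions for `y_k` and for the controls concern a whole time step and vanish
like `h`, i.e. they are `h` times a differential or pointwise condition; hence `r + 1` there. -/
def ConditionsOrder (X : P.Trajectory) (μ ν : Conf M) (α β γ : ℝ) (r : ℕ) : Prop :=
  ∀ δu : ℝ → Ctrl S, ContDiff ℝ 2 δu →
  ∃ C : ℝ, ∀ N : ℕ, 0 < N → ∀ L, P.IsExactFamily X N L →
    let A := P.approxLHS X μ ν α β γ N
    let E := P.exactLHS X μ ν N L
    (∀ k, 0 < k → k < N → ‖A.dy k - E.dy k‖ ≤ C * P.step N ^ (r + 1)) ∧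
    (∀ k < N, |A.du k δu - E.du k δu| ≤ C * P.step N ^ (r + 1)) ∧
    ‖A.dq₀ - E.dq₀‖ ≤ C * P.step N ^ r ∧
    ‖A.dqN - E.dqN‖ ≤ C * P.step N ^ r ∧
    ‖A.dμ - E.dμ‖ ≤ C * P.step N ^ r ∧
    ‖A.dν - E.dν‖ ≤ C * P.step N ^ r ∧
    ‖A.dv₀ - E.dv₀‖ ≤ C * P.step N ^ r ∧
    ‖A.dvN - E.dvN‖ ≤ C * P.step N ^ r

/-- `X` with the multipliers `μ`, `ν` solves the exact discrete optimality conditions, on every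
uniform grid. -/
def IsExactlyOptimal (X : P.Trajectory) (μ ν : Conf M) : Prop :=
  ∀ N : ℕ, 0 < N → ∃ L, P.IsExactFamily X N L ∧
    let E := P.exactLHS X μ ν N L
    (∀ k, 0 < k → k < N → E.dy k = 0) ∧
    (∀ k < N, ∀ δu : ℝ → Ctrl S, ContDiff ℝ 1 δu → E.du k δu = 0) ∧
    E.dq₀ = 0 ∧ E.dqN = 0 ∧ E.dμ = 0 ∧ E.dν = 0 ∧ E.dv₀ = 0 ∧ E.dvN = 0

end ControlProblem

end

/-! Everything is written in terms of the centre `t` and the length `h` of a time interval. The two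
evaluation points of the scheme are then `node t h` and `node t (-h)`, and divided by `h` the scheme
is `α F(node t h) + (1 - α) F(node t (-h))`. For `α = 1/2` this is even in `h` because the two terms
trade places; for `β = γ = 1/2` because the node itself is even. The exact action divided by `h` is
the mean of the Lagrangian over the centred interval, which is always even. The difference is `C^2`
in `(t, h)` and vanishes at `h = 0`, hence is `O(h)`; if it is even, its first derivative in `h`
vanishes too and it is `O(h^2)`, uniformly on a compact rectangle. The control variation is treated
in the same way.

For the other conditions, the state and adjoint equations are the Euler-Lagrange equations of the
Lagrangian, so the first variation of the exact action is `p(b) δb - p(a) δa` with the momentum `p`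
(`hasFDerivAt_action`). The end-point differentials of the scheme are `∓W + h (weighted ∂L/∂y)`,
with `W` the averaged velocity differential. Compared with `∓p` they agree to order `h^r`. In the
sum of the two differentials at an interior grid point, `W` enters through a difference over one
step; this supplies the extra factor `h` (`exists_bound_schemeD₁_add_schemeD₂`).

Order two fails already for `q'' = ι u` with polynomial trajectories, where the first-order error
coefficient can be computed: see `not_lagrangianOrder_linearTrajectory`,
`not_conditionsOrder_of_velocity` and `not_conditionsOrder_of_control`. -/

section ParametricIntegrals

/-! ### Smoothness of integrals depending on a parameter -/

open MeasureTheory Topology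

/-- Differentiation under an interval integral whose integrand is continuously differentiable in
the parameter. -/
theorem hasFDerivAt_intervalIntegral_of_continuousOn {X E : Type*} [NormedAddCommGroup X]
    [NormedSpace ℝ X] [ProperSpace X] [NormedAddCommGroup E] [NormedSpace ℝ E] {V : Set X}
    (hV : IsOpen V) {x₀ : X} (hx₀ : x₀ ∈ V) {F : X → ℝ → E} {F' : X → ℝ → X →L[ℝ] E} {a b : ℝ}
    (hF : ContinuousOn (fun p : X × ℝ => F p.1 p.2) (V ×ˢ univ))
    (hF' : ContinuousOn (fun p : X × ℝ => F' p.1 p.2) (V ×ˢ univ))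
    (hd : ∀ x ∈ V, ∀ s, HasFDerivAt (fun x => F x s) (F' x s) x) :
    HasFDerivAt (fun x => ∫ s in a..b, F x s) (∫ s in a..b, F' x₀ s) x₀ := by
  obtain ⟨r, hr, hrV⟩ := Metric.nhds_basis_closedBall.mem_iff.1 (hV.mem_nhds hx₀)
  have hcF : ∀ x ∈ V, Continuous (F x) := fun x hx =>
    hF.comp_continuous (f := fun s : ℝ => (x, s)) (by fun_prop) (fun s => ⟨hx, mem_univ _⟩)
  have hcF' : ∀ x ∈ V, Continuous (F' x) := fun x hx =>
    hF'.comp_continuous (f := fun s : ℝ => (x, s)) (by fun_prop) (fun s => ⟨hx, mem_univ _⟩)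
  have hK : IsCompact (Metric.closedBall x₀ r ×ˢ uIcc a b) :=
    (isCompact_closedBall x₀ r).prod isCompact_uIcc
  obtain ⟨C, hC⟩ := hK.exists_bound_of_continuousOn
    (hF'.mono (prod_mono hrV (subset_univ _)))
  refine intervalIntegral.hasFDerivAt_integral_of_dominated_of_fderiv_le (bound := fun _ => C)
    (Metric.closedBall_mem_nhds x₀ hr) ?_ ((hcF x₀ hx₀).intervalIntegrable _ _)
    (hcF' x₀ hx₀).aestronglyMeasurable ?_ (by simp) ?_
  · filter_upwards [hV.mem_nhds hx₀] with x hx using (hcF x hx).aestronglyMeasurable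
  · exact Filter.Eventually.of_forall fun t ht x hx => hC (x, t) ⟨hx, uIoc_subset_uIcc ht⟩
  · exact Filter.Eventually.of_forall fun t _ x hx => hd x (hrV hx) t

/-- Induction on `n`: the derivative is again such an integral, with values in `X →L[ℝ] E`. This is
why the target space is quantified inside the induction. -/
theorem contDiff_intervalIntegral {X : Type} [NormedAddCommGroup X]
    [NormedSpace ℝ X] [FiniteDimensional ℝ X] (n : ℕ) :
    ∀ {E : Type} [NormedAddCommGroup E] [NormedSpace ℝ E] {F : X → ℝ → E} (a b : ℝ),
      ContDiff ℝ n (fun p : X × ℝ => F p.1 p.2) →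
        ContDiff ℝ n (fun x => ∫ s in a..b, F x s) := by
  have : ProperSpace X := FiniteDimensional.proper ℝ X
  induction n with
  | zero =>
    intro E _ _ F a b hF
    exact contDiff_zero.2
      (intervalIntegral.continuous_parametric_intervalIntegral_of_continuous' hF.continuous a b)
  | succ n ih =>
    intro E _ _ F a b hF
    have hF1 : ContDiff ℝ n (fun p : X × ℝ =>
        (fderiv ℝ (fun p : X × ℝ => F p.1 p.2) p).comp (ContinuousLinearMap.inl ℝ X ℝ)) :=
      (hF.fderiv_right (by norm_cast)).clm_comp contDiff_const
    have hd : ∀ x : X, HasFDerivAt (fun x => ∫ s in a..b, F x s)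
        (∫ s in a..b, (fderiv ℝ (fun p : X × ℝ => F p.1 p.2) (x, s)).comp
          (ContinuousLinearMap.inl ℝ X ℝ)) x := by
      intro x
      refine hasFDerivAt_intervalIntegral_of_continuousOn (V := univ) (F' := fun x s =>
        (fderiv ℝ (fun p : X × ℝ => F p.1 p.2) (x, s)).comp (ContinuousLinearMap.inl ℝ X ℝ))
        isOpen_univ (mem_univ x) hF.continuous.continuousOn hF1.continuous.continuousOn ?_
      intro x _ s
      have h1 : HasFDerivAt (fun p : X × ℝ => F p.1 p.2) _ (x, s) :=
        ((hF.differentiable (by simp)) (x, s)).hasFDerivAt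
      exact h1.comp (g := fun p : X × ℝ => F p.1 p.2) (f := fun x => (x, s)) x
        (hasFDerivAt_prodMk_left x s)
    have h := contDiff_succ_iff_hasFDerivAt (𝕜 := ℝ) (n := n) (f := fun x => ∫ s in a..b, F x s)
    rw [Nat.cast_succ, h]
    exact ⟨_, ih a b hF1, hd⟩

end ParametricIntegrals

/-! ### Means over centred intervals -/

section Mean

variable {E : Type} [NormedAddCommGroup E] [NormedSpace ℝ E]

/-- The mean of `g` over the interval of length `h` centred at `t`. -/
noncomputable def centredMean (g : ℝ → E) (t h : ℝ) : E :=
  ∫ s in (-(1 / 2) : ℝ)..(1 / 2), g (t + s * h)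

/-- Integrating over the fixed interval `[-1/2, 1/2]` makes the mean meaningful and smooth across `h
= 0` and for negative `h`, so that parity in `h` can be used. -/
theorem contDiff_centredMean {n : ℕ} {g : ℝ → E} (hg : ContDiff ℝ n g) :
    ContDiff ℝ n (fun x : ℝ × ℝ => centredMean g x.1 x.2) :=
  contDiff_intervalIntegral (X := ℝ × ℝ) (F := fun x s => g (x.1 + s * x.2)) n _ _
    (hg.comp (by fun_prop))

theorem centredMean_neg (g : ℝ → E) (t h : ℝ) : centredMean g t (-h) = centredMean g t h := by
  have := intervalIntegral.integral_comp_neg (a := -(1 / 2 : ℝ)) (b := 1 / 2)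
    (fun s => g (t + s * h))
  simpa [centredMean] using this

theorem centredMean_zero [CompleteSpace E] (g : ℝ → E) (t : ℝ) : centredMean g t 0 = g t := by
  simp only [centredMean, mul_zero, add_zero, intervalIntegral.integral_const]
  norm_num

theorem smul_centredMean (g : ℝ → E) (t h : ℝ) :
    h • centredMean g t h = ∫ s in (t - h / 2)..(t + h / 2), g s := by
  rw [centredMean]
  simp_rw [mul_comm _ h]
  rw [intervalIntegral.smul_integral_comp_add_mul]
  congr 1 <;> ring

/-- Replaces difference quotients by means of the derivative, which removes the division by `h` from
the scheme. -/
theorem smul_centredMean_of_hasDerivAt [CompleteSpace E] {g g' : ℝ → E}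
    (hg : ∀ t, HasDerivAt g (g' t) t) (hc : Continuous g') (t h : ℝ) :
    h • centredMean g' t h = g (t + h / 2) - g (t - h / 2) := by
  rw [smul_centredMean]
  exact intervalIntegral.integral_eq_sub_of_hasDerivAt (fun s _ => hg s)
    (hc.intervalIntegrable _ _)

end Mean

/-! ### Uniform Taylor bounds in the step size -/

section TaylorBounds

variable {E : Type} [NormedAddCommGroup E] [NormedSpace ℝ E]

theorem deriv_eq_zero_of_even {f : ℝ → E} (h : ∀ x, f (-x) = f x) : deriv f 0 = 0 := by
  have h1 : deriv (fun x => f (-x)) 0 = -deriv f (-0) := deriv_comp_neg f 0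
  rw [show (fun x => f (-x)) = f from funext h, neg_zero] at h1
  have h2 : (2 : ℝ) • deriv f 0 = 0 := by
    rw [two_smul]; nth_rewrite 1 [h1]; simp
  simpa using h2

theorem hasDerivAt_zero_of_even {f : ℝ → E} (hf : DifferentiableAt ℝ f 0)
    (h : ∀ x, f (-x) = f x) : HasDerivAt f 0 0 := by
  simpa [deriv_eq_zero_of_even h] using hf.hasDerivAt

theorem exists_bound_mul_of_eq_zero {R : ℝ → ℝ → E} {T : ℝ}
    (hR : ContDiff ℝ 1 (fun x : ℝ × ℝ => R x.1 x.2)) (h0 : ∀ t ∈ Icc 0 T, R t 0 = 0) :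
    ∃ C, 0 ≤ C ∧ ∀ t ∈ Icc 0 T, ∀ h ∈ Icc 0 T, ‖R t h‖ ≤ C * h := by
  have hc : Continuous fun x : ℝ × ℝ =>
      fderiv ℝ (fun x : ℝ × ℝ => R x.1 x.2) x (0, 1) :=
    (hR.continuous_fderiv (by simp)).clm_apply continuous_const
  obtain ⟨C, hC⟩ := ((isCompact_Icc (a := (0 : ℝ)) (b := T)).prod
    (isCompact_Icc (a := (0 : ℝ)) (b := T))).exists_bound_of_continuousOn hc.continuousOn
  refine ⟨max C 0, le_max_right _ _, fun t ht h hh => ?_⟩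
  have hd : ∀ s, HasDerivAt (R t) (fderiv ℝ (fun x : ℝ × ℝ => R x.1 x.2) (t, s) (0, 1)) s := by
    intro s
    have h1 : HasFDerivAt (fun x : ℝ × ℝ => R x.1 x.2) _ (t, s) :=
      ((hR.differentiable (by simp)) (t, s)).hasFDerivAt
    exact h1.comp_hasDerivAt s ((hasDerivAt_const s t).prodMk (hasDerivAt_id s))
  have := (convex_Icc (0 : ℝ) T).norm_image_sub_le_of_norm_hasDerivWithin_le (f := R t)
    (C := max C 0) (fun s _ => (hd s).hasDerivWithinAt)
    (fun s hs => (hC (t, s) ⟨ht, hs⟩).trans (le_max_left _ _)) (left_mem_Icc.2 (hh.1.trans hh.2)) hh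
  simpa [h0 t ht, Real.norm_eq_abs, abs_of_nonneg hh.1] using this

theorem exists_bound_sq_of_hasDerivAt_zero {R : ℝ → ℝ → E} {T : ℝ}
    (hR : ContDiff ℝ 2 (fun x : ℝ × ℝ => R x.1 x.2)) (h0 : ∀ t ∈ Icc 0 T, R t 0 = 0)
    (h1 : ∀ t ∈ Icc 0 T, HasDerivAt (R t) 0 0) :
    ∃ C, 0 ≤ C ∧ ∀ t ∈ Icc 0 T, ∀ h ∈ Icc 0 T, ‖R t h‖ ≤ C * h ^ 2 := by
  set R' : ℝ → ℝ → E := fun t s => fderiv ℝ (fun x : ℝ × ℝ => R x.1 x.2) (t, s) (0, 1) with hR'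
  have hd : ∀ t s, HasDerivAt (R t) (R' t s) s := by
    intro t s
    have h1 : HasFDerivAt (fun x : ℝ × ℝ => R x.1 x.2) _ (t, s) :=
      ((hR.differentiable (by simp)) (t, s)).hasFDerivAt
    exact h1.comp_hasDerivAt s ((hasDerivAt_const s t).prodMk (hasDerivAt_id s))
  have hc : ContDiff ℝ 1 (fun x : ℝ × ℝ => R' x.1 x.2) :=
    (hR.fderiv_right (by norm_num)).clm_apply contDiff_const
  obtain ⟨C, hC0, hC⟩ := exists_bound_mul_of_eq_zero hc fun t ht => (hd t 0).unique (h1 t ht)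
  refine ⟨C, hC0, fun t ht h hh => ?_⟩
  have := (convex_Icc (0 : ℝ) h).norm_image_sub_le_of_norm_hasDerivWithin_le (f := R t)
    (C := C * h) (fun s _ => (hd t s).hasDerivWithinAt)
    (fun s hs => (hC t ht s ⟨hs.1, hs.2.trans hh.2⟩).trans
      (mul_le_mul_of_nonneg_left hs.2 hC0)) (left_mem_Icc.2 hh.1) (right_mem_Icc.2 hh.1)
  rw [h0 t ht, sub_zero, sub_zero, Real.norm_eq_abs, abs_of_nonneg hh.1] at this
  linarith

/-- The disjunction `hr` lets one argument serve both orders: order one needs only `R t 0 = 0`,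
order two also needs a vanishing first derivative, which will come from evenness or from a direct
cancellation. -/
theorem exists_bound_pow {R : ℝ → ℝ → E} {T : ℝ} {r : ℕ}
    (hR : ContDiff ℝ 2 (fun x : ℝ × ℝ => R x.1 x.2)) (h0 : ∀ t ∈ Icc 0 T, R t 0 = 0)
    (hr : r = 1 ∨ (r = 2 ∧ ∀ t ∈ Icc 0 T, HasDerivAt (R t) 0 0)) :
    ∃ C, 0 ≤ C ∧ ∀ t ∈ Icc 0 T, ∀ h ∈ Icc 0 T, ‖R t h‖ ≤ C * h ^ r := by
  rcases hr with rfl | ⟨rfl, h1⟩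
  · simpa using exists_bound_mul_of_eq_zero (hR.of_le (by norm_num)) h0
  · exact exists_bound_sq_of_hasDerivAt_zero hR h0 h1

end TaylorBounds

/-! ### Partial differentials of the Lagrangian and the Euler-Lagrange equations -/

namespace ControlProblem

variable {M S : ℕ} (P : ControlProblem M S)

/-- The Lagrangian as a function of the triple `(y, w, u)`. -/
noncomputable def jointLagrangian (x : Phase M × Phase M × Ctrl S) : ℝ :=
  P.lagrangian x.1 x.2.1 x.2.2

theorem contDiff_jointLagrangian : ContDiff ℝ 4 P.jointLagrangian := by
  have hf : ContDiff ℝ 4 (fun x : Phase M × Phase M × Ctrl S => P.f x.1.1 x.2.1.1) :=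
    P.f_smooth.comp (g := fun x : Conf M × Conf M => P.f x.1 x.2)
      (f := fun x : Phase M × Phase M × Ctrl S => (x.1.1, x.2.1.1)) (by fun_prop)
  have hρ : ContDiff ℝ 4 (fun x : Phase M × Phase M × Ctrl S => P.ρ x.1.1 x.2.2) :=
    (P.ρ_smooth.comp (contDiff_fst.comp contDiff_fst)).clm_apply (by fun_prop)
  have hg : ContDiff ℝ 4 (fun x : Phase M × Phase M × Ctrl S => P.g x.1.1 x.2.2 x.2.2) :=
    ((P.gQ_smooth.comp (contDiff_fst.comp contDiff_fst)).clm_apply hρ).clm_apply hρ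
  unfold jointLagrangian lagrangian
  exact (((by fun_prop : ContDiff ℝ 4 fun x : Phase M × Phase M × Ctrl S => x.2.1.2).inner ℝ
    (by fun_prop)).add ((by fun_prop : ContDiff ℝ 4 fun x : Phase M × Phase M × Ctrl S =>
      x.1.2).inner ℝ (hf.add hρ))).sub (contDiff_const.mul hg)

theorem contDiff_fderiv_jointLagrangian : ContDiff ℝ 3 (fderiv ℝ P.jointLagrangian) :=
  P.contDiff_jointLagrangian.fderiv_right (by norm_num)

theorem hasFDerivAt_jointLagrangian (x : Phase M × Phase M × Ctrl S) :
    HasFDerivAt P.jointLagrangian (fderiv ℝ P.jointLagrangian x) x :=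
  (P.contDiff_jointLagrangian.differentiable (by norm_num) x).hasFDerivAt

/-- The partial differential of the Lagrangian in `y`. -/
noncomputable def lagDy (x : Phase M × Phase M × Ctrl S) : Phase M →L[ℝ] ℝ :=
  (fderiv ℝ P.jointLagrangian x).comp (ContinuousLinearMap.inl ℝ _ _)

/-- The partial differential of the Lagrangian in the velocity `w`. -/
noncomputable def lagDw (x : Phase M × Phase M × Ctrl S) : Phase M →L[ℝ] ℝ :=
  ((fderiv ℝ P.jointLagrangian x).comp (ContinuousLinearMap.inr ℝ _ _)).comp
    (ContinuousLinearMap.inl ℝ _ _)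

/-- The partial differential of the Lagrangian in the control `u`. -/
noncomputable def lagDu (x : Phase M × Phase M × Ctrl S) : Ctrl S →L[ℝ] ℝ :=
  ((fderiv ℝ P.jointLagrangian x).comp (ContinuousLinearMap.inr ℝ _ _)).comp
    (ContinuousLinearMap.inr ℝ _ _)

theorem contDiff_lagDy : ContDiff ℝ 3 P.lagDy :=
  P.contDiff_fderiv_jointLagrangian.clm_comp contDiff_const

theorem contDiff_lagDw : ContDiff ℝ 3 P.lagDw :=
  (P.contDiff_fderiv_jointLagrangian.clm_comp contDiff_const).clm_comp contDiff_const

theorem contDiff_lagDu : ContDiff ℝ 3 P.lagDu :=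
  (P.contDiff_fderiv_jointLagrangian.clm_comp contDiff_const).clm_comp contDiff_const

theorem fderiv_jointLagrangian_apply (x δ : Phase M × Phase M × Ctrl S) :
    fderiv ℝ P.jointLagrangian x δ = P.lagDy x δ.1 + P.lagDw x δ.2.1 + P.lagDu x δ.2.2 := by
  have : δ = (δ.1, 0) + (0, (δ.2.1, 0)) + (0, (0, δ.2.2)) := by simp
  conv_lhs => rw [this, map_add, map_add]
  simp [lagDy, lagDw, lagDu]

theorem hasFDerivAt_lagrangian_y (y w : Phase M) (u : Ctrl S) :
    HasFDerivAt (fun y => P.lagrangian y w u) (P.lagDy (y, w, u)) y :=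
  (P.hasFDerivAt_jointLagrangian (y, w, u)).comp (f := fun y => (y, w, u)) y
    (hasFDerivAt_prodMk_left y (w, u))

theorem hasFDerivAt_lagrangian_w (y w : Phase M) (u : Ctrl S) :
    HasFDerivAt (fun w => P.lagrangian y w u) (P.lagDw (y, w, u)) w :=
  (P.hasFDerivAt_jointLagrangian (y, w, u)).comp (f := fun w => (y, w, u)) w
    ((hasFDerivAt_prodMk_right (𝕜 := ℝ) y (w, u)).comp (g := fun z => (y, z))
      (f := fun w => (w, u)) w (hasFDerivAt_prodMk_left (𝕜 := ℝ) w u))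

theorem hasFDerivAt_lagrangian_u (y w : Phase M) (u : Ctrl S) :
    HasFDerivAt (fun u => P.lagrangian y w u) (P.lagDu (y, w, u)) u :=
  (P.hasFDerivAt_jointLagrangian (y, w, u)).comp (f := fun u => (y, w, u)) u
    ((hasFDerivAt_prodMk_right (𝕜 := ℝ) y (w, u)).comp (g := fun z => (y, z))
      (f := fun u => (w, u)) u (hasFDerivAt_prodMk_right (𝕜 := ℝ) w u))

theorem lagDw_apply (y w : Phase M) (u : Ctrl S) (δ : Phase M) :
    P.lagDw (y, w, u) δ =
      ⟪w.2, δ.1⟫ + ⟪δ.2, w.1⟫ + ⟪y.2, fderiv ℝ (fun v => P.f y.1 v) w.1 δ.1⟫ := by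
  have hf : DifferentiableAt ℝ (fun v => P.f y.1 v) w.1 :=
    (P.f_smooth.differentiable (by norm_num) (y.1, w.1)).comp
      (g := fun x : Conf M × Conf M => P.f x.1 x.2) (f := fun v => (y.1, v)) w.1
      (by fun_prop : DifferentiableAt ℝ (fun v => (y.1, v)) w.1)
  have h1 : HasFDerivAt (fun w : Phase M => P.f y.1 w.1) _ w :=
    hf.hasFDerivAt.comp w hasFDerivAt_fst
  have h2 : HasFDerivAt (fun w => P.lagrangian y w u) _ w :=
    ((hasFDerivAt_snd.inner ℝ hasFDerivAt_fst).add ((hasFDerivAt_const y.2 w).inner ℝ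
      (h1.add_const (P.ρ y.1 u)))).sub_const (1 / 2 * P.g y.1 u u)
  rw [(P.hasFDerivAt_lagrangian_w y w u).unique h2]
  simp [fderivInnerCLM_apply]

theorem lagDy_apply (y w : Phase M) (u : Ctrl S) (δ : Phase M) :
    P.lagDy (y, w, u) δ =
      ⟪δ.2, P.f y.1 w.1 + P.ρ y.1 u⟫
        + ⟪y.2, fderiv ℝ (fun q => P.f q w.1) y.1 δ.1 + fderiv ℝ P.ρ y.1 δ.1 u⟫
        - 1 / 2 * fderiv ℝ (fun q => P.g q u u) y.1 δ.1 := by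
  have hf : DifferentiableAt ℝ (fun q => P.f q w.1) y.1 :=
    (P.f_smooth.differentiable (by norm_num) (y.1, w.1)).comp
      (g := fun x : Conf M × Conf M => P.f x.1 x.2) (f := fun q => (q, w.1)) y.1
      (by fun_prop : DifferentiableAt ℝ (fun q => (q, w.1)) y.1)
  have hρ : DifferentiableAt ℝ P.ρ y.1 := P.ρ_smooth.differentiable (by norm_num) y.1
  have hg : DifferentiableAt ℝ (fun q => P.g q u u) y.1 := by
    have := P.gQ_smooth.differentiable (by norm_num) y.1
    unfold g
    fun_prop
  have h1 : HasFDerivAt (fun y : Phase M => P.f y.1 w.1) _ y :=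
    hf.hasFDerivAt.comp y hasFDerivAt_fst
  have h2 : HasFDerivAt (fun y : Phase M => P.ρ y.1 u) _ y :=
    (hρ.hasFDerivAt.comp y hasFDerivAt_fst).clm_apply (hasFDerivAt_const u y)
  have h3 : HasFDerivAt (fun y : Phase M => P.g y.1 u u) _ y :=
    hg.hasFDerivAt.comp y hasFDerivAt_fst
  have h4 : HasFDerivAt (fun y => P.lagrangian y w u) _ y :=
    ((hasFDerivAt_const ⟪w.2, w.1⟫ y).add (hasFDerivAt_snd.inner ℝ (h1.add h2))).sub
      (h3.const_mul (1 / 2))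
  rw [(P.hasFDerivAt_lagrangian_y y w u).unique h4]
  simp [fderivInnerCLM_apply]
  ring

/-- The control enters the Lagrangian without the velocity. Hence the averaged velocity differential
of the scheme does not see the merely `C^2` control and is `C^3`; this spare derivative is used for
the interior conditions. -/
theorem lagDw_eq_zero_control (y w : Phase M) (u : Ctrl S) :
    P.lagDw (y, w, u) = P.lagDw (y, w, 0) := by
  ext δ <;> simp [lagDw_apply]

namespace Trajectory

variable {P} (X : P.Trajectory)

/-- The curve `t ↦ (y t, y' t, u t)`. -/
noncomputable def jet (t : ℝ) : Phase M × Phase M × Ctrl S := (X.y t, deriv X.y t, X.u t)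

/-- The momentum along a trajectory, the velocity differential of the Lagrangian. -/
noncomputable def momentum (t : ℝ) : Phase M →L[ℝ] ℝ := P.lagDw (X.jet t)

theorem contDiff_deriv_y : ContDiff ℝ 3 (deriv X.y) :=
  by
  have h := X.y_smooth
  rw [show (4 : WithTop ℕ∞) = 3 + 1 by norm_num] at h
  exact (contDiff_succ_iff_deriv.1 h).2.2

theorem contDiff_jet : ContDiff ℝ 2 X.jet :=
  (X.y_smooth.of_le (by norm_num)).prodMk ((X.contDiff_deriv_y.of_le (by norm_num)).prodMk
    X.u_smooth)

theorem hasDerivAt_y (t : ℝ) : HasDerivAt X.y (deriv X.y t) t :=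
  (X.y_smooth.differentiable (by norm_num) t).hasDerivAt

theorem contDiff_momentum : ContDiff ℝ 2 X.momentum :=
  (P.contDiff_lagDw.of_le (by norm_num)).comp X.contDiff_jet

/-- The state and adjoint equations are the Euler-Lagrange equations of the Lagrangian. -/
theorem hasDerivAt_momentum {t : ℝ} (ht : t ∈ Icc 0 P.T) :
    HasDerivAt X.momentum (P.lagDy (X.jet t)) t := by
  have hp : HasDerivAt X.momentum (deriv X.momentum t) t :=
    (X.contDiff_momentum.differentiable (by norm_num) t).hasDerivAt
  convert hp using 1
  refine ContinuousLinearMap.ext fun δ => ?_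
  have h1 : HasDerivAt (fun s => X.momentum s δ) (deriv X.momentum t δ) t := by
    simpa using hp.clm_apply (hasDerivAt_const t δ)
  have h2 : HasDerivAt (deriv X.y) (deriv (deriv X.y) t) t :=
    (X.contDiff_deriv_y.differentiable (by norm_num) t).hasDerivAt
  have h3 : HasDerivAt (fun s => ⟪(deriv X.y s).2, δ.1⟫) ⟪(deriv (deriv X.y) t).2, δ.1⟫ t := by
    simpa using (hasFDerivAt_snd.comp_hasDerivAt t h2).inner ℝ (hasDerivAt_const t δ.1)
  have h4 : HasDerivAt (fun s => ⟪δ.2, (deriv X.y s).1⟫) ⟪δ.2, (deriv (deriv X.y) t).1⟫ t := by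
    simpa using (hasDerivAt_const t δ.2).inner ℝ (hasFDerivAt_fst.comp_hasDerivAt t h2)
  have h5 := ((h1.sub h3).sub h4).deriv
  -- What remains of the momentum is exactly the function differentiated in the adjoint equation, so
  -- that derivative never has to be expanded.
  have h6 : (fun s => X.momentum s δ) - (fun s => ⟪(deriv X.y s).2, δ.1⟫)
      - (fun s => ⟪δ.2, (deriv X.y s).1⟫)
      = fun s => ⟪(X.y s).2, fderiv ℝ (fun v => P.f (X.y s).1 v) (deriv X.y s).1 δ.1⟫ := by
    funext s
    simp only [momentum, jet, lagDw_apply, Pi.sub_apply]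
    ring
  rw [h6] at h5
  obtain ⟨e1, e2⟩ := X.solves t ht
  have e3 := e2 δ.1
  rw [h5] at e3
  rw [jet, lagDy_apply, ← e1]
  linarith

end Trajectory

end ControlProblem

namespace ControlProblem

variable {M S : ℕ} {P : ControlProblem M S}

/-! ### First variation of the exact action -/

section ExactDerivative

open Topology

variable {V : Set (Phase M × Phase M)} {Y : Phase M × Phase M → ℝ → Phase M}

theorem hasFDerivAt_family (hV : IsOpen V)
    (hY : ContDiffOn ℝ 2 (fun p : (Phase M × Phase M) × ℝ => Y p.1 p.2) (V ×ˢ univ))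
    {p : (Phase M × Phase M) × ℝ} (hp : p ∈ V ×ˢ (univ : Set ℝ)) :
    HasFDerivAt (fun p : (Phase M × Phase M) × ℝ => Y p.1 p.2)
      (fderiv ℝ (fun p : (Phase M × Phase M) × ℝ => Y p.1 p.2) p) p :=
  ((hY.contDiffAt ((hV.prod isOpen_univ).mem_nhds hp)).differentiableAt (by norm_num)).hasFDerivAt

theorem hasDerivAt_family (hV : IsOpen V)
    (hY : ContDiffOn ℝ 2 (fun p : (Phase M × Phase M) × ℝ => Y p.1 p.2) (V ×ˢ univ))
    {z : Phase M × Phase M} (hz : z ∈ V) (s : ℝ) :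
    HasDerivAt (Y z) (fderiv ℝ (fun p : (Phase M × Phase M) × ℝ => Y p.1 p.2) (z, s) (0, 1)) s :=
  (hasFDerivAt_family hV hY (p := (z, s)) ⟨hz, mem_univ s⟩).comp_hasDerivAt
    (f := fun s => (z, s)) s ((hasDerivAt_const s z).prodMk (hasDerivAt_id s))

/-- The first variation of the action along a family of curves with prescribed end points. -/
theorem hasFDerivAt_action (X : P.Trajectory) {a b : ℝ} (ha : 0 ≤ a) (hab : a ≤ b) (hb : b ≤ P.T)
    (hV : IsOpen V) (hzV : (X.y a, X.y b) ∈ V)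
    (hY : ContDiffOn ℝ 2 (fun p : (Phase M × Phase M) × ℝ => Y p.1 p.2) (V ×ˢ univ))
    (hYy : ∀ s ∈ Icc a b, Y (X.y a, X.y b) s = X.y s)
    (hYe : ∀ z ∈ V, Y z a = z.1 ∧ Y z b = z.2) :
    HasFDerivAt (fun z => ∫ s in a..b, P.lagrangian (Y z s) (deriv (Y z) s) (X.u s))
      ((X.momentum b).comp (ContinuousLinearMap.snd ℝ _ _)
        - (X.momentum a).comp (ContinuousLinearMap.fst ℝ _ _)) (X.y a, X.y b) := by
  set z₀ : Phase M × Phase M := (X.y a, X.y b) with hz₀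
  set D : (Phase M × Phase M) × ℝ → ((Phase M × Phase M) × ℝ) →L[ℝ] Phase M :=
    fderiv ℝ (fun p : (Phase M × Phase M) × ℝ => Y p.1 p.2) with hDdef
  have hO : IsOpen (V ×ˢ (univ : Set ℝ)) := hV.prod isOpen_univ
  have hD : ContDiffOn ℝ 1 D (V ×ˢ univ) := hY.fderiv_of_isOpen hO (by norm_num)
  set J : (Phase M × Phase M) × ℝ → Phase M × Phase M × Ctrl S :=
    fun p => (Y p.1 p.2, D p (0, 1), X.u p.2) with hJdef
  have hJ : ContDiffOn ℝ 1 J (V ×ˢ univ) :=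
    (hY.of_le (by norm_num)).prodMk ((hD.clm_apply contDiffOn_const).prodMk
      ((X.u_smooth.of_le (by norm_num)).comp contDiff_snd).contDiffOn)
  have hF : ContDiffOn ℝ 1 (fun p => P.jointLagrangian (J p)) (V ×ˢ univ) :=
    (P.contDiff_jointLagrangian.of_le (by norm_num)).comp_contDiffOn hJ
  set F' : Phase M × Phase M → ℝ → (Phase M × Phase M) →L[ℝ] ℝ := fun z s =>
    (fderiv ℝ (fun p => P.jointLagrangian (J p)) (z, s)).comp
      (ContinuousLinearMap.inl ℝ (Phase M × Phase M) ℝ) with hF'def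
  have hF'c : ContinuousOn (fun p : (Phase M × Phase M) × ℝ => F' p.1 p.2) (V ×ˢ univ) :=
    (hF.continuousOn_fderiv_of_isOpen hO (by norm_num)).clm_comp continuousOn_const
  have key := hasFDerivAt_intervalIntegral_of_continuousOn (a := a) (b := b) hV hzV
    (F := fun z s => P.jointLagrangian (J (z, s))) (F' := F') hF.continuousOn hF'c (by
      intro z hz s
      have h1 : HasFDerivAt (fun p => P.jointLagrangian (J p)) _ (z, s) :=
        ((hF.contDiffAt (hO.mem_nhds ⟨hz, mem_univ s⟩)).differentiableAt (by norm_num)).hasFDerivAt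
      exact h1.comp (f := fun z => (z, s)) z (hasFDerivAt_prodMk_left (𝕜 := ℝ) z s))
  have heq : (fun z => ∫ s in a..b, P.lagrangian (Y z s) (deriv (Y z) s) (X.u s))
      =ᶠ[𝓝 z₀] fun z => ∫ s in a..b, P.jointLagrangian (J (z, s)) := by
    filter_upwards [hV.mem_nhds hzV] with z hz
    refine intervalIntegral.integral_congr fun s _ => ?_
    simp only [jointLagrangian, hJdef, (hasDerivAt_family hV hY hz s).deriv, hDdef]
  refine (key.congr_of_eventuallyEq heq).congr_fderiv ?_
  refine ContinuousLinearMap.ext fun δ => ?_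
  have hF'z : Continuous (F' z₀) :=
    hF'c.comp_continuous (f := fun s : ℝ => (z₀, s)) (by fun_prop) (fun s => ⟨hzV, mem_univ _⟩)
  rw [ContinuousLinearMap.intervalIntegral_apply (hF'z.intervalIntegrable _ _)]
  -- `W` is the variation field of the family in the direction `δ`. Its time derivative is the
  -- variation of the velocity, by symmetry of the second derivative; this is where the family has
  -- to be `C^2`.
  set W : ℝ → Phase M := fun s => D (z₀, s) (δ, 0) with hW
  have hDd : ∀ s, HasFDerivAt D (fderiv ℝ D (z₀, s)) (z₀, s) := fun s =>
    ((hD.contDiffAt (hO.mem_nhds ⟨hzV, mem_univ s⟩)).differentiableAt (by norm_num)).hasFDerivAt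
  have hWd : ∀ s, HasDerivAt W (fderiv ℝ D (z₀, s) (0, 1) (δ, 0)) s := by
    intro s
    have h1 : HasDerivAt (fun s => D (z₀, s)) (fderiv ℝ D (z₀, s) (0, 1)) s :=
      (hDd s).comp_hasDerivAt (f := fun s => (z₀, s)) s
        ((hasDerivAt_const s z₀).prodMk (hasDerivAt_id s))
    simpa using h1.clm_apply (hasDerivAt_const s ((δ, 0) : (Phase M × Phase M) × ℝ))
  have hsymm : ∀ s, fderiv ℝ D (z₀, s) (0, 1) (δ, 0) = fderiv ℝ D (z₀, s) (δ, 0) (0, 1) := by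
    intro s
    have h1 : ContDiffAt ℝ 2 (fun p : (Phase M × Phase M) × ℝ => Y p.1 p.2) (z₀, s) :=
      hY.contDiffAt (hO.mem_nhds ⟨hzV, mem_univ s⟩)
    exact h1.isSymmSndFDerivAt (by simp) (0, 1) (δ, 0)
  -- The family agrees with the trajectory only on `[a, b]`, so velocities are identified in the
  -- interior only; this suffices for the fundamental theorem of calculus.
  have hjet : ∀ s ∈ Ioo a b, J (z₀, s) = X.jet s := by
    intro s hs
    have h1 : Y z₀ =ᶠ[𝓝 s] X.y := by
      filter_upwards [Icc_mem_nhds hs.1 hs.2] with r hr using hYy r hr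
    simp only [hJdef, Trajectory.jet, h1.eq_of_nhds, hDdef,
      ← (hasDerivAt_family hV hY hzV s).deriv, h1.deriv_eq]
  have hF'δ : ∀ s ∈ Ioo a b, F' z₀ s δ = P.lagDy (X.jet s) (W s)
      + X.momentum s (fderiv ℝ D (z₀, s) (0, 1) (δ, 0)) := by
    intro s hs
    have h1 : HasFDerivAt (fun p : (Phase M × Phase M) × ℝ => D p (0, 1)) _ (z₀, s) :=
      (hDd s).clm_apply (hasFDerivAt_const ((0, 1) : (Phase M × Phase M) × ℝ) (z₀, s))
    have h2 : HasFDerivAt (fun p : (Phase M × Phase M) × ℝ => X.u p.2) _ (z₀, s) :=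
      (X.u_smooth.differentiable (by norm_num) s).hasFDerivAt.comp (z₀, s) hasFDerivAt_snd
    have h3 : HasFDerivAt J _ (z₀, s) :=
      (hasFDerivAt_family hV hY (p := (z₀, s)) ⟨hzV, mem_univ s⟩).prodMk (h1.prodMk h2)
    have h4 : HasFDerivAt (fun p => P.jointLagrangian (J p)) _ (z₀, s) :=
      (P.hasFDerivAt_jointLagrangian (J (z₀, s))).comp (z₀, s) h3
    simp only [hF'def, h4.fderiv, hjet s hs, hsymm s, Trajectory.momentum]
    simp [fderiv_jointLagrangian_apply, hW, hDdef]
  have hend : ∀ (c : ℝ) (π : (Phase M × Phase M) →L[ℝ] Phase M), (∀ z ∈ V, Y z c = π z) →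
      W c = π δ := by
    intro c π hc
    have h1 : HasFDerivAt (fun z => Y z c) _ z₀ :=
      (hasFDerivAt_family hV hY (p := (z₀, c)) ⟨hzV, mem_univ c⟩).comp (f := fun z => (z, c)) z₀
        (hasFDerivAt_prodMk_left (𝕜 := ℝ) z₀ c)
    have h2 : HasFDerivAt (fun z => Y z c) π z₀ :=
      π.hasFDerivAt.congr_of_eventuallyEq (by
        filter_upwards [hV.mem_nhds hzV] with z hz using hc z hz)
    simpa [hW, hDdef] using DFunLike.congr_fun (h1.unique h2) δ
  have hWc : Continuous W := continuous_iff_continuousAt.2 fun s => (hWd s).continuousAt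
  -- By the Euler-Lagrange equations the integrand is the derivative of `p(W)`, so only boundary
  -- terms survive.
  rw [intervalIntegral.integral_eq_sub_of_hasDerivAt_of_le (f := fun s => X.momentum s (W s)) hab
    (X.contDiff_momentum.continuous.clm_apply hWc).continuousOn ?_
    ((hF'z.clm_apply continuous_const).intervalIntegrable _ _)]
  · simp [hend a (ContinuousLinearMap.fst ℝ _ _) fun z hz => (hYe z hz).1,
      hend b (ContinuousLinearMap.snd ℝ _ _) fun z hz => (hYe z hz).2]
  · intro s hs
    rw [hF'δ s hs]
    exact (X.hasDerivAt_momentum ⟨ha.trans hs.1.le, hs.2.le.trans hb⟩).clm_apply (hWd s)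

end ExactDerivative

section ExactLagrangian

variable {a b : ℝ} {Ld : Phase M → Phase M → ℝ}

theorem IsExactDiscreteLagrangian.apply_endpoints (X : P.Trajectory) (hab : a ≤ b)
    (hL : P.IsExactDiscreteLagrangian X.u X.y a b Ld) :
    Ld (X.y a) (X.y b) = ∫ s in a..b, P.jointLagrangian (X.jet s) := by
  obtain ⟨V, Y, -, hzV, -, hYy, hYe⟩ := hL
  rw [(hYe _ hzV).2.2.2]
  refine intervalIntegral.integral_congr_Ioo_of_le hab fun s hs => ?_
  have h1 : Y (X.y a, X.y b) =ᶠ[nhds s] X.y := by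
    filter_upwards [Icc_mem_nhds hs.1 hs.2] with r hr using hYy r hr
  simp only [jointLagrangian, Trajectory.jet, h1.eq_of_nhds, h1.deriv_eq]

theorem IsExactDiscreteLagrangian.hasFDerivAt (X : P.Trajectory) (ha : 0 ≤ a) (hab : a ≤ b)
    (hb : b ≤ P.T) (hL : P.IsExactDiscreteLagrangian X.u X.y a b Ld) :
    HasFDerivAt (fun z : Phase M × Phase M => Ld z.1 z.2)
      ((X.momentum b).comp (ContinuousLinearMap.snd ℝ _ _)
        - (X.momentum a).comp (ContinuousLinearMap.fst ℝ _ _)) (X.y a, X.y b) := by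
  obtain ⟨V, Y, hV, hzV, hY, hYy, hYe⟩ := hL
  refine (hasFDerivAt_action X ha hab hb hV hzV hY hYy
    fun z hz => ⟨(hYe z hz).1, (hYe z hz).2.1⟩).congr_of_eventuallyEq ?_
  filter_upwards [hV.mem_nhds hzV] with z hz using (hYe z hz).2.2.2

theorem IsExactDiscreteLagrangian.hasFDerivAt_left (X : P.Trajectory) (ha : 0 ≤ a)
    (hab : a ≤ b) (hb : b ≤ P.T) (hL : P.IsExactDiscreteLagrangian X.u X.y a b Ld) :
    HasFDerivAt (fun a' => Ld a' (X.y b)) (-X.momentum a) (X.y a) := by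
  have h := (hL.hasFDerivAt X ha hab hb).comp (f := fun a' => (a', X.y b)) (X.y a)
    (hasFDerivAt_prodMk_left (𝕜 := ℝ) (X.y a) (X.y b))
  exact HasFDerivAt.congr_fderiv h (by ext <;> simp)

theorem IsExactDiscreteLagrangian.hasFDerivAt_right (X : P.Trajectory) (ha : 0 ≤ a)
    (hab : a ≤ b) (hb : b ≤ P.T) (hL : P.IsExactDiscreteLagrangian X.u X.y a b Ld) :
    HasFDerivAt (fun b' => Ld (X.y a) b') (X.momentum b) (X.y b) := by
  have h := (hL.hasFDerivAt X ha hab hb).comp (f := fun b' => (X.y a, b')) (X.y b)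
    (hasFDerivAt_prodMk_right (𝕜 := ℝ) (X.y a) (X.y b))
  exact HasFDerivAt.congr_fderiv h (by ext <;> simp)

end ExactLagrangian

end ControlProblem

/-! ### Two-point averages and their parity -/

section TwoPoint

variable {E : Type} [NormedAddCommGroup E] [NormedSpace ℝ E]

/-- The combination of the values of `G` for the steps `h` and `-h` with weights `a` and `b`. -/
noncomputable def twoPoint (a b : ℝ) (G : ℝ → ℝ → E) (t h : ℝ) : E := a • G t h + b • G t (-h)

theorem contDiff_twoPoint {n : WithTop ℕ∞} {a b : ℝ} {G : ℝ → ℝ → E}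
    (hG : ContDiff ℝ n (fun x : ℝ × ℝ => G x.1 x.2)) :
    ContDiff ℝ n (fun x : ℝ × ℝ => twoPoint a b G x.1 x.2) := by
  have h : ContDiff ℝ n (fun x : ℝ × ℝ => G x.1 (-x.2)) :=
    hG.comp (f := fun x : ℝ × ℝ => (x.1, -x.2)) (by fun_prop)
  exact (contDiff_const.smul hG).add (contDiff_const.smul h)

theorem twoPoint_zero (a b : ℝ) (G : ℝ → ℝ → E) (t : ℝ) :
    twoPoint a b G t 0 = (a + b) • G t 0 := by
  simp [twoPoint, add_smul]

theorem twoPoint_neg (a b : ℝ) (G : ℝ → ℝ → E) (t h : ℝ) :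
    twoPoint a b G t (-h) = twoPoint b a G t h := by
  simp [twoPoint, add_comm]

theorem twoPoint_of_even {a b c d : ℝ} {G : ℝ → ℝ → E} {t h : ℝ} (hG : G t (-h) = G t h)
    (hw : a + b = c + d) : twoPoint a b G t h = twoPoint c d G t h := by
  simp only [twoPoint, hG, ← add_smul, hw]

/-- Both averages equal `f t` at `h = 0` and the mean is even, so evenness of the two-point rule is
all that order two requires. -/
theorem exists_bound_twoPoint_sub_centredMean [CompleteSpace E] {α T : ℝ} {r : ℕ}
    {G : ℝ → ℝ → E} {f : ℝ → E} (hG : ContDiff ℝ 2 (fun x : ℝ × ℝ => G x.1 x.2))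
    (hf : ContDiff ℝ 2 f) (hGf : ∀ t, G t 0 = f t)
    (hr : r = 1 ∨ (r = 2 ∧
      ∀ t h, twoPoint α (1 - α) G t (-h) = twoPoint α (1 - α) G t h)) :
    ∃ C, 0 ≤ C ∧ ∀ t ∈ Icc 0 T, ∀ h ∈ Icc 0 T,
      ‖twoPoint α (1 - α) G t h - centredMean f t h‖ ≤ C * h ^ r := by
  have hR : ContDiff ℝ 2 (fun x : ℝ × ℝ =>
      twoPoint α (1 - α) G x.1 x.2 - centredMean f x.1 x.2) :=
    (contDiff_twoPoint hG).sub (contDiff_centredMean (n := 2) hf)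
  refine exists_bound_pow (R := fun t h => twoPoint α (1 - α) G t h - centredMean f t h) hR
    (fun t _ => by simp [twoPoint_zero, centredMean_zero, hGf]) (hr.imp_right fun ⟨h2, he⟩ =>
      ⟨h2, fun t _ => hasDerivAt_zero_of_even ?_ fun h => by rw [he, centredMean_neg]⟩)
  exact (hR.comp (f := fun h : ℝ => (t, h)) (by fun_prop)).differentiable (by norm_num) 0

end TwoPoint

/-! ### The scheme along a trajectory as a function of centre and step -/

namespace ControlProblem

variable {M S : ℕ} {P : ControlProblem M S}

namespace Trajectory

variable (X : P.Trajectory)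

/-- The arguments at which the scheme evaluates the Lagrangian for the first time, on the
interval of length `h` centred at `t`. The second evaluation is obtained by replacing `h` by
`-h`. -/
noncomputable def node (β γ t h : ℝ) : Phase M × Phase M × Ctrl S :=
  (γ • X.y (t - h / 2) + (1 - γ) • X.y (t + h / 2), centredMean (deriv X.y) t h,
    X.u (t + (1 / 2 - β) * h))

/-- The node of the scheme with the control set to zero. -/
noncomputable def freeNode (γ t h : ℝ) : Phase M × Phase M × Ctrl S :=
  (γ • X.y (t - h / 2) + (1 - γ) • X.y (t + h / 2), centredMean (deriv X.y) t h, 0)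

theorem contDiff_freeNode (γ : ℝ) :
    ContDiff ℝ 3 (fun x : ℝ × ℝ => X.freeNode γ x.1 x.2) := by
  have hy : ContDiff ℝ 3 X.y := X.y_smooth.of_le (by norm_num)
  exact ((((contDiff_const (c := γ)).smul (hy.comp (f := fun x : ℝ × ℝ => x.1 - x.2 / 2) (by fun_prop))).add
    ((contDiff_const (c := 1 - γ)).smul (hy.comp (f := fun x : ℝ × ℝ => x.1 + x.2 / 2) (by fun_prop))))).prodMk
      ((contDiff_centredMean (n := 3) X.contDiff_deriv_y).prodMk
        (contDiff_const (c := (0 : Ctrl S))))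

theorem contDiff_node (β γ : ℝ) : ContDiff ℝ 2 (fun x : ℝ × ℝ => X.node β γ x.1 x.2) := by
  have h := (X.contDiff_freeNode γ).of_le (m := 2) (by norm_num)
  exact h.fst.prodMk (h.snd.fst.prodMk (X.u_smooth.comp (by fun_prop)))

theorem node_zero (β γ t : ℝ) : X.node β γ t 0 = X.jet t := by
  simp [node, jet, centredMean_zero, ← add_smul]

theorem node_neg (β γ t h : ℝ) : X.node β γ t (-h) = ((1 - γ) • X.y (t - h / 2)
    + γ • X.y (t + h / 2), centredMean (deriv X.y) t h, X.u (t - (1 / 2 - β) * h)) := by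
  simp [node, centredMean_neg, neg_div, add_comm, sub_eq_add_neg]

theorem node_half_neg (t h : ℝ) : X.node (1 / 2) (1 / 2) t (-h) = X.node (1 / 2) (1 / 2) t h := by
  rw [node_neg, node]; norm_num

theorem lagDw_freeNode (β γ t h : ℝ) : P.lagDw (X.freeNode γ t h) = P.lagDw (X.node β γ t h) :=
  (P.lagDw_eq_zero_control _ _ _).symm

/-- The averaged velocity differential of the Lagrangian in the scheme. -/
noncomputable def schemeDw (α γ : ℝ) : ℝ → ℝ → Phase M →L[ℝ] ℝ :=
  twoPoint α (1 - α) fun t h => P.lagDw (X.freeNode γ t h)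

/-- The weighted differential of the Lagrangian in `y` in the scheme. -/
noncomputable def schemeDy (a b β γ : ℝ) : ℝ → ℝ → Phase M →L[ℝ] ℝ :=
  twoPoint a b fun t h => P.lagDy (X.node β γ t h)

theorem contDiff_schemeDw (α γ : ℝ) :
    ContDiff ℝ 3 (fun x : ℝ × ℝ => X.schemeDw α γ x.1 x.2) :=
  contDiff_twoPoint (P.contDiff_lagDw.comp (X.contDiff_freeNode γ))

theorem contDiff_schemeDy (a b β γ : ℝ) :
    ContDiff ℝ 2 (fun x : ℝ × ℝ => X.schemeDy a b β γ x.1 x.2) :=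
  contDiff_twoPoint ((P.contDiff_lagDy.of_le (by norm_num)).comp (X.contDiff_node β γ))

theorem schemeDw_zero (α γ t : ℝ) : X.schemeDw α γ t 0 = X.momentum t := by
  rw [schemeDw, twoPoint_zero, X.lagDw_freeNode 0, node_zero]
  simp [momentum]

theorem schemeDy_zero (a b β γ t : ℝ) : X.schemeDy a b β γ t 0 = (a + b) • P.lagDy (X.jet t) := by
  rw [schemeDy, twoPoint_zero, node_zero]

variable {α β γ : ℝ}

theorem twoPoint_node_even {E : Type} [NormedAddCommGroup E] [NormedSpace ℝ E]
    (hs : α = 1 / 2 ∨ (β = 1 / 2 ∧ γ = 1 / 2)) (F : Phase M × Phase M × Ctrl S → E) (t h : ℝ) :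
    twoPoint α (1 - α) (fun t h => F (X.node β γ t h)) t (-h)
      = twoPoint α (1 - α) (fun t h => F (X.node β γ t h)) t h := by
  rw [twoPoint_neg]
  rcases hs with rfl | ⟨rfl, rfl⟩
  · norm_num
  · exact twoPoint_of_even (by simp only [node_half_neg]) (by ring)

theorem schemeDw_neg (hs : α = 1 / 2 ∨ (β = 1 / 2 ∧ γ = 1 / 2)) (t h : ℝ) :
    X.schemeDw α γ t (-h) = X.schemeDw α γ t h := by
  simpa only [schemeDw, X.lagDw_freeNode β] using X.twoPoint_node_even hs P.lagDw t h

/-- Reversing `h` exchanges the end points: the weights of the left differential become those of the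
right one. For `α = 1/2` they are literally swapped; for `β = γ = 1/2` only their sums matter, the
node being even. -/
theorem schemeDy_neg (hs : α = 1 / 2 ∨ (β = 1 / 2 ∧ γ = 1 / 2)) (t h : ℝ) :
    X.schemeDy (α * γ) ((1 - α) * (1 - γ)) β γ t (-h)
      = X.schemeDy (α * (1 - γ)) ((1 - α) * γ) β γ t h := by
  rw [schemeDy, twoPoint_neg, schemeDy]
  rcases hs with rfl | ⟨rfl, rfl⟩
  · norm_num
  · exact twoPoint_of_even (by simp only [node_half_neg]) (by ring)

theorem schemeDy_weights (hs : α = 1 / 2 ∨ (β = 1 / 2 ∧ γ = 1 / 2)) :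
    α * γ + (1 - α) * (1 - γ) = 1 / 2 ∧ α * (1 - γ) + (1 - α) * γ = 1 / 2 := by
  rcases hs with rfl | ⟨rfl, rfl⟩ <;> constructor <;> ring

/-- The differential of the scheme in the left end point, on the interval of length `h` centred
at `t`. -/
noncomputable def schemeD₁ (α β γ t h : ℝ) : Phase M →L[ℝ] ℝ :=
  -X.schemeDw α γ t h + h • X.schemeDy (α * γ) ((1 - α) * (1 - γ)) β γ t h

/-- The differential of the scheme in the right end point, on the interval of length `h` centred
at `t`. -/
noncomputable def schemeD₂ (α β γ t h : ℝ) : Phase M →L[ℝ] ℝ :=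
  X.schemeDw α γ t h + h • X.schemeDy (α * (1 - γ)) ((1 - α) * γ) β γ t h

theorem hasDerivAt_schemeDw_zero (hs : α = 1 / 2 ∨ (β = 1 / 2 ∧ γ = 1 / 2)) (t : ℝ) :
    HasDerivAt (X.schemeDw α γ t) 0 0 :=
  hasDerivAt_zero_of_even (((X.contDiff_schemeDw α γ).comp (f := fun h : ℝ => (t, h))
    (by fun_prop)).differentiable (by norm_num) 0) (X.schemeDw_neg hs t)

theorem hasDerivAt_smul_schemeDy_zero (a b β γ t : ℝ) :
    HasDerivAt (fun h => h • X.schemeDy a b β γ t h) ((a + b) • P.lagDy (X.jet t)) 0 := by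
  have h1 : HasDerivAt (X.schemeDy a b β γ t) _ 0 :=
    (((X.contDiff_schemeDy a b β γ).comp (f := fun h : ℝ => (t, h))
      (by fun_prop)).differentiable (by norm_num) 0).hasDerivAt
  exact ((hasDerivAt_id (0 : ℝ)).smul h1).congr_deriv (by simp [schemeDy_zero])

theorem hasDerivAt_momentum_shift {t : ℝ} (ht : t ∈ Icc 0 P.T) (c : ℝ) :
    HasDerivAt (fun h => X.momentum (t + c * h)) (c • P.lagDy (X.jet t)) 0 := by
  have h1 : HasDerivAt (fun h : ℝ => t + c * h) c 0 := by
    simpa using ((hasDerivAt_id (0 : ℝ)).const_mul c).const_add t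
  have h2 : HasDerivAt X.momentum (P.lagDy (X.jet t)) (t + c * 0) := by
    simpa using X.hasDerivAt_momentum ht
  exact h2.scomp 0 h1

variable {r : ℕ}

/-- At first order in `h`, the even part `W` contributes nothing, the `y`-differential contributes
`1/2 ∂L/∂y`, and the shifted momentum contributes `-1/2 p' = -1/2 ∂L/∂y`. Intervals reaching outside
`[0, T]` are harmless: the Euler-Lagrange equation is used only at the centre `t`. -/
theorem exists_bound_schemeD₁ (α β γ : ℝ)
    (hr : r = 1 ∨ (r = 2 ∧ (α = 1 / 2 ∨ (β = 1 / 2 ∧ γ = 1 / 2)))) :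
    ∃ C, 0 ≤ C ∧ ∀ t ∈ Icc 0 P.T, ∀ h ∈ Icc 0 P.T,
      ‖X.schemeD₁ α β γ t h + X.momentum (t - h / 2)‖ ≤ C * h ^ r := by
  refine exists_bound_pow (R := fun t h => X.schemeD₁ α β γ t h + X.momentum (t - h / 2)) ?_ ?_
    (hr.imp_right fun ⟨h2, hs⟩ => ⟨h2, fun t ht => ?_⟩)
  · exact ((((X.contDiff_schemeDw α γ).of_le (by norm_num)).neg).add
      (contDiff_snd.smul (X.contDiff_schemeDy _ _ β γ))).add
        (X.contDiff_momentum.comp (by fun_prop))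
  · intro t _
    simp [schemeD₁, schemeDw_zero]
  · have h := ((X.hasDerivAt_schemeDw_zero hs t).neg.add (X.hasDerivAt_smul_schemeDy_zero
      (α * γ) ((1 - α) * (1 - γ)) β γ t)).add (X.hasDerivAt_momentum_shift ht (-(1 / 2)))
    rw [(schemeDy_weights hs).1, neg_zero, zero_add, ← add_smul, add_neg_cancel, zero_smul] at h
    convert h using 1
    funext h
    simp only [schemeD₁, Pi.add_apply, Pi.neg_apply]
    ring_nf

theorem exists_bound_schemeD₂ (α β γ : ℝ)
    (hr : r = 1 ∨ (r = 2 ∧ (α = 1 / 2 ∨ (β = 1 / 2 ∧ γ = 1 / 2)))) :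
    ∃ C, 0 ≤ C ∧ ∀ t ∈ Icc 0 P.T, ∀ h ∈ Icc 0 P.T,
      ‖X.schemeD₂ α β γ t h - X.momentum (t + h / 2)‖ ≤ C * h ^ r := by
  refine exists_bound_pow (R := fun t h => X.schemeD₂ α β γ t h - X.momentum (t + h / 2)) ?_ ?_
    (hr.imp_right fun ⟨h2, hs⟩ => ⟨h2, fun t ht => ?_⟩)
  · exact (((X.contDiff_schemeDw α γ).of_le (by norm_num)).add
      (contDiff_snd.smul (X.contDiff_schemeDy _ _ β γ))).sub
        (X.contDiff_momentum.comp (by fun_prop))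
  · intro t _
    simp [schemeD₂, schemeDw_zero]
  · have h := ((X.hasDerivAt_schemeDw_zero hs t).add (X.hasDerivAt_smul_schemeDy_zero
      (α * (1 - γ)) ((1 - α) * γ) β γ t)).sub (X.hasDerivAt_momentum_shift ht (1 / 2))
    rw [(schemeDy_weights hs).2, zero_add, sub_self] at h
    convert h using 1
    funext h
    simp only [schemeD₂, Pi.add_apply, Pi.sub_apply]
    ring_nf

/-- The separate end-point bounds give only `h^r`. Here `W(t + h/2, h) - W(t - h/2, h)` is `h` times
the mean of `∂W/∂t`, so the sum is `h R` with `R` of class `C^2` because `W` is `C^3`. At `h = 0`,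
`R` is the residual of the Euler-Lagrange equation; under the symmetry condition it is even. -/
theorem exists_bound_schemeD₁_add_schemeD₂ (α β γ : ℝ)
    (hr : r = 1 ∨ (r = 2 ∧ (α = 1 / 2 ∨ (β = 1 / 2 ∧ γ = 1 / 2)))) :
    ∃ C, 0 ≤ C ∧ ∀ t ∈ Icc 0 P.T, ∀ h ∈ Icc 0 P.T,
      ‖X.schemeD₁ α β γ (t + h / 2) h + X.schemeD₂ α β γ (t - h / 2) h‖ ≤ C * h ^ (r + 1) := by
  set W' : ℝ → ℝ → Phase M →L[ℝ] ℝ := fun t h =>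
    fderiv ℝ (fun x : ℝ × ℝ => X.schemeDw α γ x.1 x.2) (t, h) (1, 0) with hW'def
  have hW'c : ContDiff ℝ 2 (fun x : ℝ × ℝ => W' x.1 x.2) :=
    ((X.contDiff_schemeDw α γ).fderiv_right (by norm_num)).clm_apply contDiff_const
  have hW' : ∀ t h, HasDerivAt (fun t => X.schemeDw α γ t h) (W' t h) t := by
    intro t h
    have h1 : HasFDerivAt (fun x : ℝ × ℝ => X.schemeDw α γ x.1 x.2) _ (t, h) :=
      ((X.contDiff_schemeDw α γ).differentiable (by norm_num) (t, h)).hasFDerivAt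
    exact h1.comp_hasDerivAt (f := fun t => (t, h)) t
      ((hasDerivAt_id t).prodMk (hasDerivAt_const t h))
  set R : ℝ → ℝ → Phase M →L[ℝ] ℝ := fun t h =>
    -centredMean (fun s => W' s h) t h
      + (X.schemeDy (α * γ) ((1 - α) * (1 - γ)) β γ (t + h / 2) h
        + X.schemeDy (α * (1 - γ)) ((1 - α) * γ) β γ (t - h / 2) h) with hRdef
  have hR : ContDiff ℝ 2 (fun x : ℝ × ℝ => R x.1 x.2) := by
    have h1 : ContDiff ℝ 2 (fun x : ℝ × ℝ => centredMean (fun s => W' s x.2) x.1 x.2) :=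
      contDiff_intervalIntegral (X := ℝ × ℝ) (F := fun x s => W' (x.1 + s * x.2) x.2) 2 _ _
        (hW'c.comp (f := fun p : (ℝ × ℝ) × ℝ => (p.1.1 + p.2 * p.1.2, p.1.2)) (by fun_prop))
    have h2 : ∀ a b c : ℝ, ContDiff ℝ 2 (fun x : ℝ × ℝ =>
        X.schemeDy a b β γ (x.1 + c * x.2) x.2) := fun a b c =>
      (X.contDiff_schemeDy a b β γ).comp (f := fun x : ℝ × ℝ => (x.1 + c * x.2, x.2))
        (by fun_prop)
    have h3 : (fun x : ℝ × ℝ => R x.1 x.2) = fun x => -centredMean (fun s => W' s x.2) x.1 x.2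
        + (X.schemeDy (α * γ) ((1 - α) * (1 - γ)) β γ (x.1 + 1 / 2 * x.2) x.2
          + X.schemeDy (α * (1 - γ)) ((1 - α) * γ) β γ (x.1 + -(1 / 2) * x.2) x.2) := by
      funext x
      simp only [hRdef]
      ring_nf
    rw [h3]
    exact h1.neg.add ((h2 _ _ _).add (h2 _ _ _))
  have hRs : ∀ t h, X.schemeD₁ α β γ (t + h / 2) h + X.schemeD₂ α β γ (t - h / 2) h
      = h • R t h := by
    intro t h
    have h1 := smul_centredMean_of_hasDerivAt (fun t => hW' t h)
      (hW'c.continuous.comp (f := fun t : ℝ => (t, h)) (by fun_prop)) t h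
    simp only [hRdef, smul_add, smul_neg, h1, schemeD₁, schemeD₂]
    abel
  obtain ⟨C, hC0, hC⟩ := exists_bound_pow (T := P.T) (r := r) hR (fun t ht => by
      have h1 : W' t 0 = P.lagDy (X.jet t) := by
        refine (hW' t 0).unique ?_
        simpa only [schemeDw_zero] using X.hasDerivAt_momentum ht
      simp only [hRdef, centredMean_zero, h1, zero_div, add_zero, sub_zero, schemeDy_zero]
      rw [← add_smul, show α * γ + (1 - α) * (1 - γ) + (α * (1 - γ) + (1 - α) * γ) = 1 by ring,
        one_smul, neg_add_cancel])
    (hr.imp_right fun ⟨h2, hs⟩ => ⟨h2, fun t ht => hasDerivAt_zero_of_even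
      ((hR.comp (f := fun h : ℝ => (t, h)) (by fun_prop)).differentiable (by norm_num) 0)
      fun h => by
        have h3 : ∀ s, W' s (-h) = W' s h := fun s => by
          refine (hW' s (-h)).unique ?_
          simpa only [X.schemeDw_neg hs] using hW' s h
        -- Under `h ↦ -h` the contributions of the two neighbouring intervals trade places.
        have h4 := X.schemeDy_neg hs (t - h / 2) h
        have h5 := X.schemeDy_neg hs (t + h / 2) (-h)
        rw [neg_neg] at h5
        simp only [hRdef, centredMean_neg, h3]
        rw [show t + -h / 2 = t - h / 2 by ring, show t - -h / 2 = t + h / 2 by ring, h4, ← h5,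
          add_comm (X.schemeDy (α * (1 - γ)) ((1 - α) * γ) β γ (t - h / 2) h)]⟩)
  refine ⟨C, hC0, fun t ht h hh => ?_⟩
  rw [hRs, norm_smul, Real.norm_eq_abs, abs_of_nonneg hh.1]
  calc h * ‖R t h‖ ≤ h * (C * h ^ r) := mul_le_mul_of_nonneg_left (hC t ht h hh) hh.1
    _ = C * h ^ (r + 1) := by ring

end Trajectory

end ControlProblem

/-! ### Differentials of the scheme and their values on the grid -/

namespace ControlProblem

variable {M S : ℕ} {P : ControlProblem M S}

section SchemeDerivatives

theorem hasFDerivAt_jointLagrangian_comp {A : Phase M → Phase M × Phase M × Ctrl S} {c e : ℝ}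
    {a : Phase M} (hA : HasFDerivAt A ((c • ContinuousLinearMap.id ℝ (Phase M)).prod
      ((e • ContinuousLinearMap.id ℝ (Phase M)).prod 0)) a) :
    HasFDerivAt (fun a => P.jointLagrangian (A a)) (c • P.lagDy (A a) + e • P.lagDw (A a)) a := by
  refine ((P.hasFDerivAt_jointLagrangian (A a)).comp a hA).congr_fderiv ?_
  refine ContinuousLinearMap.ext fun δ => ?_
  simp [fderiv_jointLagrangian_apply]

theorem hasFDerivAt_approxLagrangian_left (α γ h : ℝ) (a b : Phase M) (U : Ctrl S × Ctrl S) :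
    HasFDerivAt (fun a => P.approxLagrangian α γ h a b U)
      (h • (α • (γ • P.lagDy (γ • a + (1 - γ) • b, h⁻¹ • (b - a), U.1)
          + (-h⁻¹) • P.lagDw (γ • a + (1 - γ) • b, h⁻¹ • (b - a), U.1))
        + (1 - α) • ((1 - γ) • P.lagDy ((1 - γ) • a + γ • b, h⁻¹ • (b - a), U.2)
          + (-h⁻¹) • P.lagDw ((1 - γ) • a + γ • b, h⁻¹ • (b - a), U.2)))) a := by
  have hA : ∀ (c d : ℝ) (V : Ctrl S), HasFDerivAt
      (fun a : Phase M => (c • a + d • b, h⁻¹ • (b - a), V))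
      ((c • ContinuousLinearMap.id ℝ (Phase M)).prod
        (((-h⁻¹) • ContinuousLinearMap.id ℝ (Phase M)).prod 0)) a := by
    intro c d V
    refine ((((hasFDerivAt_id a).const_smul c).add_const (d • b)).prodMk
      ((((hasFDerivAt_id a).const_sub b).const_smul h⁻¹).prodMk
        (hasFDerivAt_const V a))).congr_fderiv ?_
    refine ContinuousLinearMap.ext fun δ => ?_
    simp
  exact ((((hasFDerivAt_jointLagrangian_comp (P := P) (hA γ (1 - γ) U.1)).const_smul α).add
    ((hasFDerivAt_jointLagrangian_comp (P := P) (hA (1 - γ) γ U.2)).const_smul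
      (1 - α))).const_smul h)

theorem hasFDerivAt_approxLagrangian_right (α γ h : ℝ) (a b : Phase M) (U : Ctrl S × Ctrl S) :
    HasFDerivAt (fun b => P.approxLagrangian α γ h a b U)
      (h • (α • ((1 - γ) • P.lagDy (γ • a + (1 - γ) • b, h⁻¹ • (b - a), U.1)
          + h⁻¹ • P.lagDw (γ • a + (1 - γ) • b, h⁻¹ • (b - a), U.1))
        + (1 - α) • (γ • P.lagDy ((1 - γ) • a + γ • b, h⁻¹ • (b - a), U.2)
          + h⁻¹ • P.lagDw ((1 - γ) • a + γ • b, h⁻¹ • (b - a), U.2)))) b := by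
  have hA : ∀ (c d : ℝ) (V : Ctrl S), HasFDerivAt
      (fun b : Phase M => (d • a + c • b, h⁻¹ • (b - a), V))
      ((c • ContinuousLinearMap.id ℝ (Phase M)).prod
        ((h⁻¹ • ContinuousLinearMap.id ℝ (Phase M)).prod 0)) b := by
    intro c d V
    exact (((hasFDerivAt_id b).const_smul c).const_add (d • a)).prodMk
      ((((hasFDerivAt_id b).sub_const a).const_smul h⁻¹).prodMk (hasFDerivAt_const V b))
  exact ((((hasFDerivAt_jointLagrangian_comp (P := P) (hA (1 - γ) γ U.1)).const_smul α).add
    ((hasFDerivAt_jointLagrangian_comp (P := P) (hA γ (1 - γ) U.2)).const_smul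
      (1 - α))).const_smul h)

theorem hasFDerivAt_approxLagrangian_control (α γ h : ℝ) (a b : Phase M) (U : Ctrl S × Ctrl S) :
    HasFDerivAt (fun U => P.approxLagrangian α γ h a b U)
      (h • (α • (P.lagDu (γ • a + (1 - γ) • b, h⁻¹ • (b - a), U.1)).comp
          (ContinuousLinearMap.fst ℝ _ _)
        + (1 - α) • (P.lagDu ((1 - γ) • a + γ • b, h⁻¹ • (b - a), U.2)).comp
          (ContinuousLinearMap.snd ℝ _ _))) U :=
  (((((P.hasFDerivAt_lagrangian_u _ _ U.1).comp U hasFDerivAt_fst).const_smul α).add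
    (((P.hasFDerivAt_lagrangian_u _ _ U.2).comp U hasFDerivAt_snd).const_smul
      (1 - α))).const_smul h)

end SchemeDerivatives

section Velocities

theorem gradient_inr {L : Phase M → ℝ} {a : Phase M} {L' : Phase M →L[ℝ] ℝ}
    (hL : HasFDerivAt L L' a) : gradient (fun l => L (a.1, l)) a.2
      = (InnerProductSpace.toDual ℝ (Conf M)).symm (L'.comp (ContinuousLinearMap.inr ℝ _ _)) := by
  have h1 : HasFDerivAt (fun l => L (a.1, l)) (L'.comp (ContinuousLinearMap.inr ℝ _ _)) a.2 :=
    HasFDerivAt.comp (g := L) (f := fun l => (a.1, l)) a.2 hL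
      (hasFDerivAt_prodMk_right (𝕜 := ℝ) a.1 a.2)
  rw [gradient, h1.fderiv]

theorem norm_toDual_symm_inr_sub_le (L L' : Phase M →L[ℝ] ℝ) :
    ‖(InnerProductSpace.toDual ℝ (Conf M)).symm (L.comp (ContinuousLinearMap.inr ℝ _ _))
      - (InnerProductSpace.toDual ℝ (Conf M)).symm (L'.comp (ContinuousLinearMap.inr ℝ _ _))‖
      ≤ ‖L - L'‖ := by
  rw [← map_sub, LinearIsometryEquiv.norm_map, ← ContinuousLinearMap.sub_comp]
  exact (ContinuousLinearMap.opNorm_comp_le _ _).trans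
    (mul_le_of_le_one_right (norm_nonneg _) (ContinuousLinearMap.norm_inr_le_one ℝ _ _))

theorem norm_comp_inl_sub_le (L L' : Phase M →L[ℝ] ℝ) :
    ‖L.comp (ContinuousLinearMap.inl ℝ (Conf M) (Conf M))
      - L'.comp (ContinuousLinearMap.inl ℝ (Conf M) (Conf M))‖ ≤ ‖L - L'‖ := by
  rw [← ContinuousLinearMap.sub_comp]
  exact (ContinuousLinearMap.opNorm_comp_le _ _).trans
    (mul_le_of_le_one_right (norm_nonneg _) (ContinuousLinearMap.norm_inl_le_one ℝ _ _))

end Velocities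

section Grid

variable {N k : ℕ}

/-- The midpoint of the `k`-th interval of the grid. -/
noncomputable def centre (P : ControlProblem M S) (N k : ℕ) : ℝ := P.grid N k + P.step N / 2

theorem step_pos (hN : 0 < N) : 0 < P.step N :=
  div_pos P.T_pos (Nat.cast_pos.2 hN)

theorem step_mem_Icc (hN : 0 < N) : P.step N ∈ Icc 0 P.T :=
  ⟨(step_pos hN).le, div_le_self P.T_pos.le (Nat.one_le_cast.2 hN)⟩

theorem grid_succ : P.grid N (k + 1) = P.grid N k + P.step N := by
  simp only [grid]; push_cast; ring

theorem grid_zero : P.grid N 0 = 0 := by simp [grid]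

theorem grid_last (hN : 0 < N) : P.grid N N = P.T := by
  have : (N : ℝ) ≠ 0 := Nat.cast_ne_zero.2 hN.ne'
  simp only [grid, step]; field_simp

theorem grid_mono (hN : 0 < N) : Monotone (P.grid N) := fun _ _ hij =>
  mul_le_mul_of_nonneg_right (Nat.cast_le.2 hij) (step_pos hN).le

theorem grid_mem_Icc (hN : 0 < N) (hk : k ≤ N) : P.grid N k ∈ Icc 0 P.T :=
  ⟨grid_zero (P := P) (N := N) ▸ grid_mono hN (Nat.zero_le k),
    grid_last (P := P) hN ▸ grid_mono hN hk⟩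

theorem centre_sub : P.centre N k - P.step N / 2 = P.grid N k := by simp [centre]

theorem centre_add : P.centre N k + P.step N / 2 = P.grid N (k + 1) := by
  rw [grid_succ, centre]; ring

theorem centre_mem_Icc (hN : 0 < N) (hk : k < N) : P.centre N k ∈ Icc 0 P.T := by
  have h1 := (grid_mem_Icc (P := P) hN hk.le).1
  have h2 := (grid_mem_Icc (P := P) hN (Nat.succ_le_of_lt hk)).2
  have h3 := step_pos (P := P) hN
  rw [Nat.succ_eq_add_one, grid_succ] at h2
  constructor <;> simp only [centre] <;> linarith

theorem sample_eq (β : ℝ) (w : ℝ → Ctrl S) : P.sample N β k w =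
    (w (P.centre N k + (1 / 2 - β) * P.step N), w (P.centre N k - (1 / 2 - β) * P.step N)) := by
  simp only [sample, midTime, centre, grid_succ]
  congr 2 <;> ring

theorem inv_step_smul_sub (X : P.Trajectory) (hN : 0 < N) :
    (P.step N)⁻¹ • (X.y (P.grid N (k + 1)) - X.y (P.grid N k))
      = centredMean (deriv X.y) (P.centre N k) (P.step N) := by
  rw [← centre_add, ← centre_sub, ← smul_centredMean_of_hasDerivAt X.hasDerivAt_y
    X.contDiff_deriv_y.continuous, inv_smul_smul₀ (step_pos hN).ne']

theorem node_centre (X : P.Trajectory) (hN : 0 < N) (β γ : ℝ) :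
    (γ • X.y (P.grid N k) + (1 - γ) • X.y (P.grid N (k + 1)),
      (P.step N)⁻¹ • (X.y (P.grid N (k + 1)) - X.y (P.grid N k)), (P.sample N β k X.u).1)
      = X.node β γ (P.centre N k) (P.step N) := by
  rw [inv_step_smul_sub X hN, sample_eq, Trajectory.node, centre_sub, centre_add]

theorem node_centre_neg (X : P.Trajectory) (hN : 0 < N) (β γ : ℝ) :
    ((1 - γ) • X.y (P.grid N k) + γ • X.y (P.grid N (k + 1)),
      (P.step N)⁻¹ • (X.y (P.grid N (k + 1)) - X.y (P.grid N k)), (P.sample N β k X.u).2)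
      = X.node β γ (P.centre N k) (-P.step N) := by
  rw [inv_step_smul_sub X hN, sample_eq, Trajectory.node_neg, centre_sub, centre_add]

theorem approxLagrangian_grid (X : P.Trajectory) (hN : 0 < N) (α β γ : ℝ) :
    P.approxLagrangian α γ (P.step N) (X.y (P.grid N k)) (X.y (P.grid N (k + 1)))
        (P.sample N β k X.u) = P.step N * twoPoint α (1 - α)
      (fun t h => P.jointLagrangian (X.node β γ t h)) (P.centre N k) (P.step N) := by
  rw [twoPoint, ← node_centre X hN, ← node_centre_neg X hN]
  rfl

theorem hasFDerivAt_approxLagrangian_grid_left (X : P.Trajectory) (hN : 0 < N) (α β γ : ℝ) :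
    HasFDerivAt (fun a => P.approxLagrangian α γ (P.step N) a (X.y (P.grid N (k + 1)))
        (P.sample N β k X.u)) (X.schemeD₁ α β γ (P.centre N k) (P.step N))
      (X.y (P.grid N k)) := by
  refine (hasFDerivAt_approxLagrangian_left α γ (P.step N) _ _ _).congr_fderiv ?_
  have h0 := (step_pos (P := P) hN).ne'
  rw [node_centre X hN, node_centre_neg X hN]
  refine ContinuousLinearMap.ext fun δ => ?_
  simp only [Trajectory.schemeD₁, Trajectory.schemeDw, Trajectory.schemeDy, twoPoint,
    X.lagDw_freeNode β, add_apply, smul_apply,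
    neg_apply, smul_eq_mul]
  field_simp
  ring

theorem hasFDerivAt_approxLagrangian_grid_right (X : P.Trajectory) (hN : 0 < N) (α β γ : ℝ) :
    HasFDerivAt (fun b => P.approxLagrangian α γ (P.step N) (X.y (P.grid N k)) b
        (P.sample N β k X.u)) (X.schemeD₂ α β γ (P.centre N k) (P.step N))
      (X.y (P.grid N (k + 1))) := by
  refine (hasFDerivAt_approxLagrangian_right α γ (P.step N) _ _ _).congr_fderiv ?_
  have h0 := (step_pos (P := P) hN).ne'
  rw [node_centre X hN, node_centre_neg X hN]
  refine ContinuousLinearMap.ext fun δ => ?_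
  simp only [Trajectory.schemeD₂, Trajectory.schemeDw, Trajectory.schemeDy, twoPoint,
    X.lagDw_freeNode β, add_apply, smul_apply,
    smul_eq_mul]
  field_simp
  ring

theorem fderiv_approxLagrangian_grid_control (X : P.Trajectory) (hN : 0 < N) (α β γ : ℝ)
    (δu : ℝ → Ctrl S) :
    fderiv ℝ (fun U => P.approxLagrangian α γ (P.step N) (X.y (P.grid N k))
        (X.y (P.grid N (k + 1))) U) (P.sample N β k X.u) (P.sample N β k δu)
      = P.step N * twoPoint α (1 - α)
        (fun t h => P.lagDu (X.node β γ t h) (δu (t + (1 / 2 - β) * h)))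
        (P.centre N k) (P.step N) := by
  rw [(hasFDerivAt_approxLagrangian_control α γ (P.step N) _ _ _).fderiv,
    node_centre X hN, node_centre_neg X hN, sample_eq]
  simp [twoPoint, sub_eq_add_neg, mul_add]

theorem integral_grid (f : ℝ → ℝ) :
    ∫ s in (P.grid N k)..(P.grid N (k + 1)), f s
      = P.step N * centredMean f (P.centre N k) (P.step N) := by
  rw [← smul_eq_mul, smul_centredMean, centre_sub, centre_add]

end Grid

/-! ### Exact discrete differentials and velocities -/

section ExactConditions

variable {X : P.Trajectory} {N k : ℕ} {L : ℕ → Phase M → Phase M → ℝ}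

theorem IsExactFamily.hasFDerivAt_left (hL : P.IsExactFamily X N L) (hN : 0 < N) (hk : k < N) :
    HasFDerivAt (fun a => L k a (X.y (P.grid N (k + 1)))) (-X.momentum (P.grid N k))
      (X.y (P.grid N k)) :=
  (hL k hk).hasFDerivAt_left X (grid_mem_Icc hN hk.le).1 (grid_mono hN k.le_succ)
    (grid_mem_Icc hN (Nat.succ_le_of_lt hk)).2

theorem IsExactFamily.hasFDerivAt_right (hL : P.IsExactFamily X N L) (hN : 0 < N) (hk : k < N) :
    HasFDerivAt (fun b => L k (X.y (P.grid N k)) b) (X.momentum (P.grid N (k + 1)))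
      (X.y (P.grid N (k + 1))) :=
  (hL k hk).hasFDerivAt_right X (grid_mem_Icc hN hk.le).1 (grid_mono hN k.le_succ)
    (grid_mem_Icc hN (Nat.succ_le_of_lt hk)).2

theorem toDual_symm_momentum_inr (X : P.Trajectory) (t : ℝ) :
    (InnerProductSpace.toDual ℝ (Conf M)).symm
      ((X.momentum t).comp (ContinuousLinearMap.inr ℝ _ _)) = (deriv X.y t).1 := by
  rw [LinearIsometryEquiv.symm_apply_eq]
  refine ContinuousLinearMap.ext fun x => ?_
  simp [Trajectory.momentum, Trajectory.jet, lagDw_apply, real_inner_comm]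

theorem IsExactFamily.velMinus_eq (hL : P.IsExactFamily X N L) (hN : 0 < N) (hk : k < N) :
    velMinus (L k) (X.y (P.grid N k)) (X.y (P.grid N (k + 1)))
      = (deriv X.y (P.grid N k)).1 := by
  rw [velMinus, gradient_inr (hL.hasFDerivAt_left hN hk), ContinuousLinearMap.neg_comp, map_neg,
    neg_neg, toDual_symm_momentum_inr]

theorem IsExactFamily.velPlus_eq (hL : P.IsExactFamily X N L) (hN : 0 < N) (hk : k < N) :
    velPlus (L k) (X.y (P.grid N k)) (X.y (P.grid N (k + 1)))
      = (deriv X.y (P.grid N (k + 1))).1 := by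
  rw [velPlus, gradient_inr (hL.hasFDerivAt_right hN hk), toDual_symm_momentum_inr]

end ExactConditions

/-! ### Approximation to order one and order two -/

section Orders

variable (X : P.Trajectory) {α β γ : ℝ} {r : ℕ}

theorem lagrangianOrder (hr : r = 1 ∨ (r = 2 ∧ (α = 1 / 2 ∨ (β = 1 / 2 ∧ γ = 1 / 2)))) :
    P.LagrangianOrder X α β γ r := by
  obtain ⟨C, hC0, hC⟩ := exists_bound_twoPoint_sub_centredMean (α := α) (T := P.T) (r := r)
    (G := fun t h => P.jointLagrangian (X.node β γ t h)) (f := fun t => P.jointLagrangian (X.jet t))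
    ((P.contDiff_jointLagrangian.of_le (by norm_num)).comp (X.contDiff_node β γ))
    ((P.contDiff_jointLagrangian.of_le (by norm_num)).comp X.contDiff_jet)
    (fun t => by rw [X.node_zero])
    (hr.imp_right fun ⟨h2, hs⟩ => ⟨h2, X.twoPoint_node_even hs P.jointLagrangian⟩)
  refine ⟨C, fun N hN L hL k hk => ?_⟩
  rw [(hL k hk).apply_endpoints X (grid_mono hN k.le_succ), approxLagrangian_grid X hN,
    integral_grid, ← mul_sub, abs_mul, abs_of_pos (step_pos hN)]
  calc _ ≤ P.step N * (C * P.step N ^ r) := mul_le_mul_of_nonneg_left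
        (hC _ (centre_mem_Icc hN hk) _ (step_mem_Icc hN)) (step_pos hN).le
    _ = C * P.step N ^ (r + 1) := by ring

theorem exists_bound_control
    (hr : r = 1 ∨ (r = 2 ∧ (α = 1 / 2 ∨ (β = 1 / 2 ∧ γ = 1 / 2))))
    {δu : ℝ → Ctrl S} (hδ : ContDiff ℝ 2 δu) :
    ∃ C, 0 ≤ C ∧ ∀ N : ℕ, 0 < N → ∀ k < N,
      |fderiv ℝ (fun U => P.approxLagrangian α γ (P.step N) (X.y (P.grid N k))
          (X.y (P.grid N (k + 1))) U) (P.sample N β k X.u) (P.sample N β k δu)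
        - ∫ s in (P.grid N k)..(P.grid N (k + 1)),
          fderiv ℝ (fun w => P.lagrangian (X.y s) (deriv X.y s) w) (X.u s) (δu s)|
        ≤ C * P.step N ^ (r + 1) := by
  obtain ⟨C, hC0, hC⟩ := exists_bound_twoPoint_sub_centredMean (α := α) (T := P.T) (r := r)
    (G := fun t h => P.lagDu (X.node β γ t h) (δu (t + (1 / 2 - β) * h)))
    (f := fun t => P.lagDu (X.jet t) (δu t))
    (((P.contDiff_lagDu.of_le (by norm_num)).comp (X.contDiff_node β γ)).clm_apply
      (hδ.comp (by fun_prop)))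
    (((P.contDiff_lagDu.of_le (by norm_num)).comp X.contDiff_jet).clm_apply hδ)
    (fun t => by rw [X.node_zero]; simp)
    -- `twoPoint_node_even` does not apply, since `δu` is sampled as well; its offset `(1/2 - β) h`
    -- vanishes when `β = 1/2`.
    (hr.imp_right fun ⟨h2, hs⟩ => ⟨h2, fun t h => by
      rcases hs with rfl | ⟨rfl, rfl⟩
      · rw [twoPoint_neg]; norm_num
      · rw [twoPoint_neg]
        exact twoPoint_of_even (by simp only [X.node_half_neg]; simp) (by ring)⟩)
  refine ⟨C, hC0, fun N hN k hk => ?_⟩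
  simp only [(P.hasFDerivAt_lagrangian_u _ _ _).fderiv]
  rw [fderiv_approxLagrangian_grid_control X hN, integral_grid, ← mul_sub, abs_mul,
    abs_of_pos (step_pos hN)]
  calc _ ≤ P.step N * (C * P.step N ^ r) := mul_le_mul_of_nonneg_left
        (hC _ (centre_mem_Icc hN hk) _ (step_mem_Icc hN)) (step_pos hN).le
    _ = C * P.step N ^ (r + 1) := by ring

/-- The terminal conditions evaluate the differentials of `φ` at the discrete final velocity; local
Lipschitz continuity transfers the order of that velocity to them. -/
theorem exists_lipschitz_terminalCost (q v₀ : Conf M) (B : ℝ) :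
    ∃ K, 0 ≤ K ∧ (∀ v, ‖v - v₀‖ ≤ B →
      ‖fderiv ℝ (fun q => P.φ q v) q - fderiv ℝ (fun q => P.φ q v₀) q‖ ≤ K * ‖v - v₀‖) ∧
      ∀ v, ‖v - v₀‖ ≤ B →
        ‖fderiv ℝ (fun v => P.φ q v) v - fderiv ℝ (fun v => P.φ q v) v₀‖ ≤ K * ‖v - v₀‖ := by
  set Φ := fderiv ℝ (fun x : Conf M × Conf M => P.φ x.1 x.2) with hΦ
  have hd : ∀ v, HasFDerivAt (fun x : Conf M × Conf M => P.φ x.1 x.2) (Φ (q, v)) (q, v) :=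
    fun v => (P.φ_smooth.differentiable (by norm_num) _).hasFDerivAt
  have h1 : ∀ v, fderiv ℝ (fun q => P.φ q v) q
      = (Φ (q, v)).comp (ContinuousLinearMap.inl ℝ _ _) := fun v =>
    ((hd v).comp (f := fun q => (q, v)) q (hasFDerivAt_prodMk_left (𝕜 := ℝ) q v)).fderiv
  have h2 : ∀ v, fderiv ℝ (fun v => P.φ q v) v
      = (Φ (q, v)).comp (ContinuousLinearMap.inr ℝ _ _) := fun v =>
    ((hd v).comp (f := fun v => (q, v)) v (hasFDerivAt_prodMk_right (𝕜 := ℝ) q v)).fderiv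
  have hc : ContDiff ℝ 1 fun v => Φ (q, v) :=
    (P.φ_smooth.fderiv_right (by norm_num)).comp (by fun_prop)
  obtain ⟨K, hK⟩ := (isCompact_closedBall v₀ B).exists_bound_of_continuousOn
    (hc.continuous_fderiv (by norm_num)).continuousOn
  have hL : ∀ v, ‖v - v₀‖ ≤ B → ‖Φ (q, v) - Φ (q, v₀)‖ ≤ max K 0 * ‖v - v₀‖ := by
    intro v hv
    refine (convex_closedBall v₀ B).norm_image_sub_le_of_norm_fderiv_le (𝕜 := ℝ)
      (f := fun v => Φ (q, v)) (fun x _ => hc.differentiable (by norm_num) x)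
      (fun x hx => (hK x hx).trans (le_max_left _ _))
      (Metric.mem_closedBall_self ((norm_nonneg _).trans hv)) (by simpa [dist_eq_norm] using hv)
  refine ⟨max K 0, le_max_right _ _, fun v hv => ?_, fun v hv => ?_⟩
  · rw [h1, h1]
    exact (norm_comp_inl_sub_le _ _).trans (hL v hv)
  · rw [h2, h2, ← ContinuousLinearMap.sub_comp]
    exact ((ContinuousLinearMap.opNorm_comp_le _ _).trans (mul_le_of_le_one_right (norm_nonneg _)
      (ContinuousLinearMap.norm_inr_le_one ℝ _ _))).trans (hL v hv)

theorem conditionsOrder (μ ν : Conf M)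
    (hr : r = 1 ∨ (r = 2 ∧ (α = 1 / 2 ∨ (β = 1 / 2 ∧ γ = 1 / 2)))) :
    P.ConditionsOrder X μ ν α β γ r := by
  intro δu hδ
  obtain ⟨C₁, hC₁0, hC₁⟩ := X.exists_bound_schemeD₁ α β γ hr
  obtain ⟨C₂, hC₂0, hC₂⟩ := X.exists_bound_schemeD₂ α β γ hr
  obtain ⟨C₃, hC₃0, hC₃⟩ := X.exists_bound_schemeD₁_add_schemeD₂ α β γ hr
  obtain ⟨C₄, hC₄0, hC₄⟩ := exists_bound_control X hr hδ
  set v₀ : Conf M := (InnerProductSpace.toDual ℝ (Conf M)).symm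
    ((X.momentum P.T).comp (ContinuousLinearMap.inr ℝ _ _)) with hv₀
  -- Since `h ≤ T`, this ball contains the discrete final velocities of all grids, so `K` is
  -- independent of `N`.
  obtain ⟨K, hK0, hK₁, hK₂⟩ := exists_lipschitz_terminalCost (P := P) (X.y P.T).1 v₀
    (C₂ * P.T ^ r)
  set C := C₁ + C₂ + C₃ + C₄ + K * C₂ with hC
  have hKC : 0 ≤ K * C₂ := mul_nonneg hK0 hC₂0
  refine ⟨C, fun N hN L hL => ?_⟩
  have hh := step_mem_Icc (P := P) hN
  have hpow : ∀ n, 0 ≤ P.step N ^ n := fun n => pow_nonneg hh.1 n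
  have hle : ∀ {x c : ℝ} {n : ℕ}, x ≤ c * P.step N ^ n → c ≤ C → x ≤ C * P.step N ^ n :=
    fun hx hc => hx.trans (mul_le_mul_of_nonneg_right hc (hpow _))
  have hE₁ : ∀ k < N, discD₁ (L k) (X.y (P.grid N k)) (X.y (P.grid N (k + 1)))
      = -X.momentum (P.grid N k) := fun k hk => (hL.hasFDerivAt_left hN hk).fderiv
  have hE₂ : ∀ k < N, discD₂ (L k) (X.y (P.grid N k)) (X.y (P.grid N (k + 1)))
      = X.momentum (P.grid N (k + 1)) := fun k hk => (hL.hasFDerivAt_right hN hk).fderiv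
  have hD₁ : ∀ k, HasFDerivAt (fun a => P.approxLagrangian α γ (P.step N) a
      (X.y (P.grid N (k + 1))) (P.sample N β k X.u)) _ _ := fun k =>
    hasFDerivAt_approxLagrangian_grid_left X hN α β γ
  have hD₂ : ∀ k, HasFDerivAt (fun b => P.approxLagrangian α γ (P.step N) (X.y (P.grid N k)) b
      (P.sample N β k X.u)) _ _ := fun k =>
    hasFDerivAt_approxLagrangian_grid_right X hN α β γ
  have hB₁ : ‖X.schemeD₁ α β γ (P.centre N 0) (P.step N) - -X.momentum (P.grid N 0)‖
      ≤ C₁ * P.step N ^ r := by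
    have := hC₁ _ (centre_mem_Icc hN hN) _ hh
    rwa [centre_sub, ← sub_neg_eq_add] at this
  obtain ⟨n, rfl⟩ : ∃ n, N = n + 1 := ⟨N - 1, by omega⟩
  have hB₂ : ‖X.schemeD₂ α β γ (P.centre (n + 1) n) (P.step (n + 1)) - X.momentum P.T‖
      ≤ C₂ * P.step (n + 1) ^ r := by
    have := hC₂ _ (centre_mem_Icc hN n.lt_succ_self) _ hh
    rwa [centre_add, grid_last hN] at this
  have hvE₁ : velMinus (L 0) (X.y (P.grid (n + 1) 0)) (X.y (P.grid (n + 1) (0 + 1)))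
      = -(InnerProductSpace.toDual ℝ (Conf M)).symm
        ((-X.momentum (P.grid (n + 1) 0)).comp (ContinuousLinearMap.inr ℝ _ _)) :=
    congrArg Neg.neg (gradient_inr (hL.hasFDerivAt_left hN hN))
  have hvE₂ : velPlus (L n) (X.y (P.grid (n + 1) n)) (X.y (P.grid (n + 1) (n + 1))) = v₀ := by
    rw [velPlus, gradient_inr (hL.hasFDerivAt_right hN n.lt_succ_self), hv₀, grid_last hN]
  have hvA₁ : velMinus (fun a b => P.approxLagrangian α γ (P.step (n + 1)) a b
      (P.sample (n + 1) β 0 X.u)) (X.y (P.grid (n + 1) 0)) (X.y (P.grid (n + 1) (0 + 1)))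
      = -(InnerProductSpace.toDual ℝ (Conf M)).symm ((X.schemeD₁ α β γ (P.centre (n + 1) 0)
        (P.step (n + 1))).comp (ContinuousLinearMap.inr ℝ _ _)) :=
    congrArg Neg.neg (gradient_inr (hD₁ 0))
  have hvA₂ : velPlus (fun a b => P.approxLagrangian α γ (P.step (n + 1)) a b
      (P.sample (n + 1) β n X.u)) (X.y (P.grid (n + 1) n)) (X.y (P.grid (n + 1) (n + 1)))
      = (InnerProductSpace.toDual ℝ (Conf M)).symm ((X.schemeD₂ α β γ (P.centre (n + 1) n)
        (P.step (n + 1))).comp (ContinuousLinearMap.inr ℝ _ _)) :=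
    gradient_inr (hD₂ n)
  set vA := (InnerProductSpace.toDual ℝ (Conf M)).symm ((X.schemeD₂ α β γ (P.centre (n + 1) n)
        (P.step (n + 1))).comp (ContinuousLinearMap.inr ℝ _ _)) with hvA
  have hv : ‖vA - v₀‖ ≤ C₂ * P.step (n + 1) ^ r := (norm_toDual_symm_inr_sub_le _ _).trans hB₂
  have hvB : ‖vA - v₀‖ ≤ C₂ * P.T ^ r :=
    hv.trans (mul_le_mul_of_nonneg_left (pow_le_pow_left₀ hh.1 hh.2 r) hC₂0)
  have hKv : K * ‖vA - v₀‖ ≤ K * C₂ * P.step (n + 1) ^ r := by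
    rw [mul_assoc]; exact mul_le_mul_of_nonneg_left hv hK0
  intro A E
  refine ⟨fun k hk0 hkN => ?_, fun k hk => ?_, ?_, ?_, ?_, ?_, ?_, ?_⟩
  · obtain ⟨j, rfl⟩ : ∃ j, k = j + 1 := ⟨k - 1, by omega⟩
    simp only [A, E, approxLHS, exactLHS, optimalityLHS, Nat.add_sub_cancel]
    rw [hE₁ _ hkN, hE₂ _ (j.lt_succ_self.trans hkN), discD₁, discD₂, (hD₁ (j + 1)).fderiv,
      (hD₂ j).fderiv, neg_add_cancel, sub_zero]
    have := hC₃ _ (grid_mem_Icc hN hkN.le) _ hh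
    rw [← centre, ← centre_add, add_sub_cancel_right] at this
    exact hle this (by linarith)
  · exact hle (hC₄ (n + 1) hN k hk) (by linarith)
  · simp only [A, E, approxLHS, exactLHS, optimalityLHS]
    rw [sub_sub_sub_cancel_left, norm_sub_rev]
    refine hle ((norm_comp_inl_sub_le _ _).trans ?_) (by linarith : C₁ ≤ C)
    rw [hE₁ 0 hN, discD₁, (hD₁ 0).fderiv]
    exact hB₁
  · simp only [A, E, approxLHS, exactLHS, optimalityLHS, Nat.add_sub_cancel]
    rw [hvE₂, hvA₂, hE₂ n n.lt_succ_self, discD₂, (hD₂ n).fderiv, grid_last hN, sub_sub_sub_comm]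
    refine hle ((norm_sub_le _ _).trans (add_le_add ((hK₁ _ hvB).trans hKv)
      ((norm_comp_inl_sub_le _ _).trans hB₂)) |>.trans_eq (add_mul _ _ _).symm) (by linarith)
  · simp only [A, E, approxLHS, exactLHS, optimalityLHS, sub_self, norm_zero]
    exact mul_nonneg (by linarith) (hpow r)
  · simp only [A, E, approxLHS, exactLHS, optimalityLHS]
    rw [sub_sub_sub_cancel_right]
    refine hle ?_ (by linarith : C₁ ≤ C)
    have h1 : ∀ x y : Conf M, -x - -y = -(x - y) := fun x y => by abel
    simp only [zero_add] at hvE₁ hvA₁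
    rw [hvE₁, hvA₁, h1, norm_neg]
    exact (norm_toDual_symm_inr_sub_le _ _).trans hB₁
  · simp only [A, E, approxLHS, exactLHS, optimalityLHS, sub_self, norm_zero]
    exact mul_nonneg (by linarith) (hpow r)
  · simp only [A, E, approxLHS, exactLHS, optimalityLHS, Nat.add_sub_cancel]
    rw [hvE₂, hvA₂, grid_last hN, add_sub_add_left_eq_sub]
    exact hle ((hK₂ _ hvB).trans hKv) (by linarith)

end Orders

end ControlProblem

/-! ### A linear test problem with polynomial trajectories -/

theorem exists_linearIsometry_euclideanSpace {S M : ℕ} (h : S ≤ M) :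
    Nonempty (EuclideanSpace ℝ (Fin S) →ₗᵢ[ℝ] EuclideanSpace ℝ (Fin M)) := by
  let b := EuclideanSpace.basisFun (Fin S) ℝ
  let c := EuclideanSpace.basisFun (Fin M) ℝ
  refine ⟨(b.toBasis.constr ℝ fun i => c (Fin.castLE h i)).isometryOfOrthonormal
    (v := b.toBasis) (by simp) ?_⟩
  have : (b.toBasis.constr ℝ fun i => c (Fin.castLE h i)) ∘ b.toBasis
      = c ∘ Fin.castLE h := by
    funext i
    simp
  rw [this]
  exact c.orthonormal.comp _ (Fin.castLE_injective h)

/-- Detects failure of order two: an error `κ h + K h^2` that is `O(h^2)` along `h = 1/N` has no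
linear term. -/
theorem eq_zero_of_forall_abs_le {κ K C : ℝ}
    (h : ∀ N : ℕ, 0 < N → |κ * (1 / N) + K * (1 / N) ^ 2| ≤ C * (1 / N : ℝ) ^ 2) : κ = 0 := by
  by_contra hκ
  obtain ⟨N, hN⟩ := exists_nat_gt (max ((C + |K|) / |κ|) 0)
  have hN0 : (0 : ℝ) < N := (le_max_right _ _).trans_lt hN
  have h1 : C + |K| < N * |κ| := by
    have := (le_max_left _ _).trans_lt hN
    rwa [div_lt_iff₀ (abs_pos.2 hκ)] at this
  have h2 := h N (Nat.cast_pos.1 hN0)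
  have h3 : |κ * (1 / N)| ≤ |κ * (1 / N) + K * (1 / N) ^ 2| + |K * (1 / N : ℝ) ^ 2| := by
    have := abs_sub (κ * (1 / N) + K * (1 / N) ^ 2) (K * (1 / N : ℝ) ^ 2)
    rwa [add_sub_cancel_right] at this
  rw [abs_mul, abs_mul, abs_of_pos (one_div_pos.2 hN0), abs_of_nonneg (sq_nonneg (1 / (N : ℝ)))]
    at h3
  have h4 : |κ| * (1 / N) ≤ (C + |K|) * (1 / N : ℝ) ^ 2 := by linarith
  have h5 : |κ| * N ≤ C + |K| := by
    have := mul_le_mul_of_nonneg_right h4 (sq_nonneg (N : ℝ))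
    field_simp at this
    linarith
  linarith

theorem abs_le_mul_sq_of_abs_mul_le {h x C : ℝ} (hh : 0 < h) (hx : |h * x| ≤ C * h ^ (2 + 1)) :
    |x| ≤ C * h ^ 2 := by
  rw [abs_mul, abs_of_pos hh] at hx
  refine le_of_mul_le_mul_left (hx.trans_eq ?_) hh
  ring

namespace ControlProblem

variable {M S : ℕ} (ι : Ctrl S →ₗᵢ[ℝ] Conf M) (e : Ctrl S) (c d : ℝ)

/-- The control problem `q'' = ι u` on `[0, 1]` with the Euclidean metric and a linear terminal
cost. -/
noncomputable def linearProblem : ControlProblem M S where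
  f _ _ := 0
  ρ _ := ι.toContinuousLinearMap
  gQ _ := innerSL ℝ
  -- Fitted to the adjoint `λ(t) = (c + d t) ι e`: the differentials of this cost are `λ'(1)` in `q`
  -- and `-λ(1)` in `v`, as the terminal conditions demand.
  φ q v := ⟪d • ι e, q⟫ - ⟪(c + d) • ι e, v⟫
  qInit := 0
  vInit := 0
  T := 1
  T_pos := one_pos
  f_smooth := contDiff_const
  ρ_smooth := contDiff_const
  gQ_smooth := contDiff_const
  φ_smooth := (contDiff_const.inner ℝ contDiff_fst).sub (contDiff_const.inner ℝ contDiff_snd)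
  ρ_injective _ := ι.injective
  gQ_symm _ v w := real_inner_comm w v
  gQ_pos _ _ hv := real_inner_self_pos.2 hv

theorem linearProblem_lagrangian (y w : Phase M) (u : Ctrl S) :
    (linearProblem ι e c d).lagrangian y w u = ⟪w.2, w.1⟫ + ⟪y.2, ι u⟫ - 1 / 2 * ⟪u, u⟫ := by
  rw [← ι.inner_map_map u u, lagrangian]
  change ⟪w.2, w.1⟫ + ⟪y.2, 0 + ι u⟫ - 1 / 2 * ⟪ι u, ι u⟫ = _
  rw [zero_add]

theorem linearProblem_solvesOn_iff (u : ℝ → Ctrl S) (y : ℝ → Phase M) (a b : ℝ) :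
    (linearProblem ι e c d).SolvesOn u y a b ↔
      ∀ t ∈ Icc a b, deriv (deriv y) t = (ι (u t), 0) := by
  refine forall₂_congr fun t _ => ?_
  simp only [linearProblem, g, fderiv_fun_const, Prod.ext_iff]
  simp [ext_iff_inner_right ℝ (x := (deriv (deriv y) t).2)]

theorem linearProblem_lagDu (y w : Phase M) (u δ : Ctrl S) :
    (linearProblem ι e c d).lagDu (y, w, u) δ = ⟪y.2, ι δ⟫ - ⟪u, δ⟫ := by
  have h2 : HasFDerivAt (fun u : Ctrl S => ⟪y.2, ι u⟫)
      ((innerSL ℝ y.2).comp ι.toContinuousLinearMap) u :=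
    ((innerSL ℝ y.2).comp ι.toContinuousLinearMap).hasFDerivAt
  have h3 : HasFDerivAt (fun u : Ctrl S => ⟪u, u⟫) _ u :=
    (hasFDerivAt_id u).inner ℝ (hasFDerivAt_id u)
  have h4 := (h2.const_add ⟪w.2, w.1⟫).sub (h3.const_mul (1 / 2 : ℝ))
  have h1 : (fun u => (linearProblem ι e c d).lagrangian y w u)
      = (fun u => ⟪w.2, w.1⟫ + ⟪y.2, ι u⟫) - fun u => 1 / 2 * ⟪u, u⟫ :=
    funext fun u => linearProblem_lagrangian ι e c d y w u
  rw [← h1] at h4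
  rw [((linearProblem ι e c d).hasFDerivAt_lagrangian_u y w u).unique h4]
  simp [fderivInnerCLM_apply, real_inner_comm]
  ring

/-- The problem is linear, so its two-point boundary value problems can be solved by adding an
affine curve to a given solution. -/
theorem exists_isExactDiscreteLagrangian_linearProblem (X : (linearProblem ι e c d).Trajectory)
    {a b : ℝ} (ha : 0 ≤ a) (hab : a < b) (hb : b ≤ 1) :
    ∃ Ld, (linearProblem ι e c d).IsExactDiscreteLagrangian X.u X.y a b Ld := by
  have h0 : b - a ≠ 0 := (sub_pos.2 hab).ne'
  set Y : Phase M × Phase M → ℝ → Phase M := fun z s =>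
    X.y s + ((b - s) / (b - a)) • (z.1 - X.y a) + ((s - a) / (b - a)) • (z.2 - X.y b) with hY
  have hd : ∀ z s, HasDerivAt (Y z)
      (deriv X.y s + ((-1) / (b - a)) • (z.1 - X.y a) + (1 / (b - a)) • (z.2 - X.y b)) s := by
    intro z s
    exact ((X.hasDerivAt_y s).add ((((hasDerivAt_id s).const_sub b).div_const (b - a)).smul_const
      (z.1 - X.y a))).add ((((hasDerivAt_id s).sub_const a).div_const (b - a)).smul_const
        (z.2 - X.y b))
  refine ⟨fun p q => ∫ s in a..b,
    (linearProblem ι e c d).lagrangian (Y (p, q) s) (deriv (Y (p, q)) s) (X.u s), univ, Y,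
    isOpen_univ, mem_univ _, ?_, fun s _ => by simp [hY], fun z _ => ⟨?_, ?_, ?_, rfl⟩⟩
  · have h1 : ContDiff ℝ 2 X.y := X.y_smooth.of_le (by norm_num)
    have h2 : ContDiff ℝ 2 (fun p : (Phase M × Phase M) × ℝ => X.y p.2) := h1.comp contDiff_snd
    have h3 : ContDiff ℝ 2 (fun p : (Phase M × Phase M) × ℝ =>
        ((b - p.2) / (b - a)) • (p.1.1 - X.y a)) :=
      ((contDiff_const.sub contDiff_snd).div_const _).smul (contDiff_fst.fst.sub contDiff_const)
    have h4 : ContDiff ℝ 2 (fun p : (Phase M × Phase M) × ℝ =>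
        ((p.2 - a) / (b - a)) • (p.1.2 - X.y b)) :=
      ((contDiff_snd.sub contDiff_const).div_const _).smul (contDiff_fst.snd.sub contDiff_const)
    exact ((h2.add h3).add h4).contDiffOn
  · simp [hY, div_self h0]
  · simp [hY, div_self h0]
  · rw [linearProblem_solvesOn_iff]
    intro t ht
    have h1 := (linearProblem_solvesOn_iff ι e c d _ _ _ _).1 X.solves t
      ⟨ha.trans ht.1, ht.2.trans hb⟩
    rw [show deriv (Y z) = fun s => _ from funext fun s => (hd z s).deriv, ← h1]
    simp only [add_assoc]
    exact deriv_add_const _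

theorem exists_isExactFamily_linearProblem (X : (linearProblem ι e c d).Trajectory) {N : ℕ}
    (hN : 0 < N) : ∃ L, (linearProblem ι e c d).IsExactFamily X N L := by
  have h : ∀ k, ∃ Ld, k < N → (linearProblem ι e c d).IsExactDiscreteLagrangian X.u X.y
      ((linearProblem ι e c d).grid N k) ((linearProblem ι e c d).grid N (k + 1)) Ld := by
    intro k
    by_cases hk : k < N
    · obtain ⟨Ld, hLd⟩ := exists_isExactDiscreteLagrangian_linearProblem ι e c d X
        (grid_mem_Icc hN hk.le).1 (by rw [grid_succ]; exact lt_add_of_pos_right _ (step_pos hN))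
        (grid_mem_Icc (P := linearProblem ι e c d) hN (Nat.succ_le_of_lt hk)).2
      exact ⟨Ld, fun _ => hLd⟩
    · exact ⟨0, fun h => absurd h hk⟩
  choose L hL using h
  exact ⟨L, hL⟩

variable (a b : ℝ)

theorem hasDerivAt_linearTrajectory (t : ℝ) :
    HasDerivAt (fun t : ℝ => ((a * t ^ 2 / 2 + b * t ^ 3 / 6) • ι e, (c + d * t) • ι e))
      ((a * t + b * t ^ 2 / 2) • ι e, d • ι e) t := by
  have h1 : HasDerivAt (fun t : ℝ => a * t ^ 2 / 2 + b * t ^ 3 / 6) (a * t + b * t ^ 2 / 2) t := by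
    refine ((((hasDerivAt_pow 2 t).const_mul a).div_const 2).add
      (((hasDerivAt_pow 3 t).const_mul b).div_const 6)).congr_deriv ?_
    norm_num; ring
  have h2 : HasDerivAt (fun t : ℝ => c + d * t) d t := by
    simpa using ((hasDerivAt_id t).const_mul d).const_add c
  exact (h1.smul_const _).prodMk (h2.smul_const _)

theorem deriv_linearTrajectory :
    deriv (fun t : ℝ => ((a * t ^ 2 / 2 + b * t ^ 3 / 6) • ι e, (c + d * t) • ι e))
      = fun t => ((a * t + b * t ^ 2 / 2) • ι e, d • ι e) :=
  funext fun t => (hasDerivAt_linearTrajectory ι e c d a b t).deriv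

/-- The trajectory with control `a + b t` and adjoint `c + d t` in a fixed direction. -/
noncomputable def linearTrajectory : (linearProblem ι e c d).Trajectory where
  y t := ((a * t ^ 2 / 2 + b * t ^ 3 / 6) • ι e, (c + d * t) • ι e)
  u t := (a + b * t) • e
  y_smooth := by fun_prop
  u_smooth := by fun_prop
  solves := by
    rw [linearProblem_solvesOn_iff]
    intro t _
    rw [deriv_linearTrajectory]
    have h1 : HasDerivAt (fun t : ℝ => a * t + b * t ^ 2 / 2) (a + b * t) t := by
      refine (((hasDerivAt_id t).const_mul a).add
        (((hasDerivAt_pow 2 t).const_mul b).div_const 2)).congr_deriv ?_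
      norm_num; ring
    simpa using ((h1.smul_const (ι e)).prodMk (hasDerivAt_const t (d • ι e))).deriv

theorem linearProblem_lagrangian_smul (he : ‖e‖ = 1) (x l v w s : ℝ) :
    (linearProblem ι e c d).lagrangian (x • ι e, l • ι e) (v • ι e, w • ι e) (s • e)
      = w * v + l * s - 1 / 2 * s ^ 2 := by
  have h1 : ⟪e, e⟫ = 1 := by rw [real_inner_self_eq_norm_sq, he, one_pow]
  rw [linearProblem_lagrangian, map_smul]
  simp only [real_inner_smul_left, real_inner_smul_right, ι.inner_map_map, h1]
  ring

end ControlProblem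

/-! ### Failure of order two -/

namespace ControlProblem

variable {M S : ℕ} (ι : Ctrl S →ₗᵢ[ℝ] Conf M) (e : Ctrl S) (c d a b : ℝ)

theorem linearProblem_step (N : ℕ) : (linearProblem ι e c d).step N = 1 / N := rfl

theorem linearProblem_approxLagrangian (he : ‖e‖ = 1) (α γ h x₀ l₀ x₁ l₁ s₁ s₂ : ℝ) :
    (linearProblem ι e c d).approxLagrangian α γ h (x₀ • ι e, l₀ • ι e) (x₁ • ι e, l₁ • ι e)
        (s₁ • e, s₂ • e)
      = h * (α * ((h⁻¹ * (l₁ - l₀)) * (h⁻¹ * (x₁ - x₀)) + (γ * l₀ + (1 - γ) * l₁) * s₁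
            - 1 / 2 * s₁ ^ 2)
          + (1 - α) * ((h⁻¹ * (l₁ - l₀)) * (h⁻¹ * (x₁ - x₀)) + ((1 - γ) * l₀ + γ * l₁) * s₂
            - 1 / 2 * s₂ ^ 2)) := by
  simp only [approxLagrangian, Prod.smul_mk, Prod.mk_add_mk, Prod.mk_sub_mk, smul_smul, ← add_smul,
    ← sub_smul, linearProblem_lagrangian_smul ι e c d he]

theorem linearProblem_lagDy_inr (y w : Phase M) (u : Ctrl S) (x : Conf M) :
    (linearProblem ι e c d).lagDy (y, w, u) (0, x) = ⟪x, ι u⟫ := by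
  rw [lagDy_apply]
  simp [linearProblem]

theorem linearProblem_lagDw (y w δ : Phase M) (u : Ctrl S) :
    (linearProblem ι e c d).lagDw (y, w, u) δ = ⟪w.2, δ.1⟫ + ⟪δ.2, w.1⟫ := by
  rw [lagDw_apply]
  simp [linearProblem]

theorem linearTrajectory_momentum (t : ℝ) (δ : Phase M) :
    (linearTrajectory ι e c d a b).momentum t δ
      = ⟪d • ι e, δ.1⟫ + ⟪δ.2, (a * t + b * t ^ 2 / 2) • ι e⟫ := by
  rw [Trajectory.momentum, Trajectory.jet, linearProblem_lagDw]
  simp only [linearTrajectory, deriv_linearTrajectory]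

theorem integral_linearTrajectory (he : ‖e‖ = 1) (t₀ t₁ : ℝ) :
    ∫ s in t₀..t₁, (linearProblem ι e c d).jointLagrangian
        ((linearTrajectory ι e c d 0 1).jet s)
      = (d * t₁ ^ 3 / 2 + c * t₁ ^ 2 / 2 - t₁ ^ 3 / 6)
        - (d * t₀ ^ 3 / 2 + c * t₀ ^ 2 / 2 - t₀ ^ 3 / 6) := by
  have h1 : ∀ s, (linearProblem ι e c d).jointLagrangian ((linearTrajectory ι e c d 0 1).jet s)
      = d * (s ^ 2 / 2) + (c + d * s) * s - 1 / 2 * s ^ 2 := by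
    intro s
    simp only [jointLagrangian, Trajectory.jet, linearTrajectory, deriv_linearTrajectory,
      linearProblem_lagrangian_smul ι e c d he]
    ring
  simp only [h1]
  refine intervalIntegral.integral_eq_sub_of_hasDerivAt
    (f := fun s => d * s ^ 3 / 2 + c * s ^ 2 / 2 - s ^ 3 / 6) (fun s _ => ?_)
    (Continuous.intervalIntegrable (by fun_prop) _ _)
  refine (((((hasDerivAt_pow 3 s).const_mul d).div_const 2).add
    (((hasDerivAt_pow 2 s).const_mul c).div_const 2)).sub
      ((hasDerivAt_pow 3 s).div_const 6)).congr_deriv ?_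
  norm_num
  ring

/-- The adjoint is sampled at offset `±(1/2 - γ) h` and the control at `±(1/2 - β) h` from the
centre. As `u(1) = 1`, `λ' = d`, `u' = 1` and `∂L/∂u = λ - u` equals `c + d - 1` at time `1`, the
number in `hκ` is the linear error coefficient there. -/
theorem not_lagrangianOrder_linearTrajectory (he : ‖e‖ = 1) {α β γ : ℝ}
    (hκ : (2 * α - 1) * ((1 / 2 - γ) * d + (1 / 2 - β) * (c + d - 1)) ≠ 0) :
    ¬ (linearProblem ι e c d).LagrangianOrder (linearTrajectory ι e c d 0 1) α β γ 2 := by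
  rintro ⟨C, hC⟩
  refine hκ (eq_zero_of_forall_abs_le (C := C)
    -- The first bracket is the quadratic error at the centre; the last term arises from expanding
    -- the linear coefficient at time `1` instead of at the centre `1 - h/2`.
    (K := (d * (1 / 2 - γ) * (1 / 2 - β) - 1 / 2 * (1 / 2 - β) ^ 2 - (d - 1 / 2) / 12)
      - (2 * α - 1) * ((1 / 2 - γ) * d + (1 / 2 - β) * (d - 1)) / 2) fun N hN => ?_)
  obtain ⟨L, hL⟩ := exists_isExactFamily_linearProblem ι e c d (linearTrajectory ι e c d 0 1) hN
  -- Only the last interval is tested: for `t` near `0` the control, and with it part of the error,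
  -- would be small.
  obtain ⟨n, rfl⟩ : ∃ n, N = n + 1 := ⟨N - 1, by omega⟩
  have h1 := hC (n + 1) hN L hL n n.lt_succ_self
  have hh := step_pos (P := linearProblem ι e c d) hN
  rw [(hL n n.lt_succ_self).apply_endpoints _ (grid_mono hN n.le_succ),
    integral_linearTrajectory ι e c d he] at h1
  have ht₁ : (linearProblem ι e c d).grid (n + 1) (n + 1) = 1 := grid_last hN
  have ht₀ : (linearProblem ι e c d).grid (n + 1) n
      = 1 - (linearProblem ι e c d).step (n + 1) := by
    rw [← ht₁, grid_succ, add_sub_cancel_right]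
  simp only [linearTrajectory, sample, midTime, ht₁, ht₀,
    linearProblem_approxLagrangian ι e c d he] at h1
  rw [← linearProblem_step ι e c d]
  generalize (linearProblem ι e c d).step (n + 1) = h at h1 hh
  refine abs_le_mul_sq_of_abs_mul_le hh (le_of_eq_of_le (congrArg _ ?_) h1)
  field_simp
  ring

/-- With the control equal to the adjoint, the trajectory is a critical point. -/
theorem isExactlyOptimal_linearTrajectory :
    (linearProblem ι e c d).IsExactlyOptimal (linearTrajectory ι e c d c d)
      (-(d • ι e)) (c • ι e) := by
  intro N hN
  obtain ⟨L, hL⟩ := exists_isExactFamily_linearProblem ι e c d (linearTrajectory ι e c d c d) hN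
  refine ⟨L, hL, ?_⟩
  have hE₁ : ∀ k < N, _ := fun k hk => (hL.hasFDerivAt_left hN hk).fderiv
  have hE₂ : ∀ k < N, _ := fun k hk => (hL.hasFDerivAt_right hN hk).fderiv
  have hvm := hL.velMinus_eq hN hN
  have hvp := hL.velPlus_eq hN (Nat.sub_lt hN one_pos)
  have hN1 : N - 1 + 1 = N := Nat.sub_add_cancel hN
  have hlast := hE₂ (N - 1) (Nat.sub_lt hN one_pos)
  rw [hN1] at hvp hlast
  have hT : (linearProblem ι e c d).grid N N = 1 := grid_last hN
  intro E
  refine ⟨fun k hk0 hkN => ?_, fun k _ δu _ => ?_, ?_, ?_, ?_, ?_, ?_, ?_⟩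
  · obtain ⟨j, rfl⟩ : ∃ j, k = j + 1 := ⟨k - 1, by omega⟩
    simp only [E, exactLHS, optimalityLHS, Nat.add_sub_cancel, discD₁, discD₂]
    rw [hE₁ _ hkN, hE₂ _ (j.lt_succ_self.trans hkN), neg_add_cancel]
  · simp only [E, exactLHS, optimalityLHS]
    refine (intervalIntegral.integral_congr fun s _ => ?_).trans intervalIntegral.integral_zero
    simp only [(hasFDerivAt_lagrangian_u _ _ _ _).fderiv, linearProblem_lagDu, linearTrajectory]
    rw [real_inner_smul_left, real_inner_smul_left, ι.inner_map_map, sub_self]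
  · simp only [E, exactLHS, optimalityLHS, discD₁]
    rw [hE₁ 0 hN]
    refine ContinuousLinearMap.ext fun x => ?_
    simp [linearTrajectory_momentum, real_inner_smul_left]
  · simp only [E, exactLHS, optimalityLHS, discD₂]
    rw [hlast]
    have h1 : ∀ v q, HasFDerivAt (fun q => (linearProblem ι e c d).φ q v)
        (innerSL ℝ (d • ι e)) q := fun v q => (innerSL ℝ (d • ι e)).hasFDerivAt.sub_const _
    rw [(h1 _ _).fderiv]
    refine ContinuousLinearMap.ext fun x => ?_
    simp [linearTrajectory_momentum, real_inner_smul_left]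
  · simp [E, exactLHS, optimalityLHS, linearTrajectory, linearProblem, grid_zero]
  · simp only [E, exactLHS, optimalityLHS]
    rw [hvm]
    simp [linearTrajectory, deriv_linearTrajectory, grid_zero, linearProblem]
  · simp [E, exactLHS, optimalityLHS, linearTrajectory, grid_zero]
  · simp only [E, exactLHS, optimalityLHS]
    have h1 : ∀ q v, HasFDerivAt (fun v => (linearProblem ι e c d).φ q v)
        (-innerSL ℝ ((c + d) • ι e)) v := fun q v =>
      (innerSL ℝ ((c + d) • ι e)).hasFDerivAt.const_sub _
    rw [(h1 _ _).fderiv, hT]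
    simp [linearTrajectory]

/-- Tests the initial velocity. The exact condition vanishes, and the scheme leaves a linear term in
`h` with coefficient `2 (α - 1/2) (γ - 1/2)` up to sign. -/
theorem not_conditionsOrder_of_velocity (he : ‖e‖ = 1) {α β γ : ℝ}
    (hα : α ≠ 1 / 2) (hγ : γ ≠ 1 / 2) (μ ν : Conf M)
    (hX : (linearProblem ι e 1 1).IsExactlyOptimal (linearTrajectory ι e 1 1 1 1) μ ν) :
    ¬ (linearProblem ι e 1 1).ConditionsOrder (linearTrajectory ι e 1 1 1 1) μ ν α β γ 2 := by
  intro hcond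
  obtain ⟨C, hC⟩ := hcond 0 contDiff_const
  have hκ : α * γ + (1 - α) * (1 - γ) - 1 / 2 = 0 := by
    refine eq_zero_of_forall_abs_le (C := C)
      (K := -1 / 6 + α * γ * (1 - β) + (1 - α) * (1 - γ) * β) fun N hN => ?_
    obtain ⟨L, hL, -, -, -, -, -, hE, -, -⟩ := hX N hN
    obtain ⟨-, -, -, -, -, hA, -⟩ := hC N hN L hL
    rw [hE, sub_zero] at hA
    simp only [approxLHS, optimalityLHS] at hA
    rw [velMinus, gradient_inr (hasFDerivAt_approxLagrangian_left α γ _ _ _ _)] at hA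
    have hh := step_pos (P := linearProblem ι e 1 1) hN
    have h1 : ⟪e, e⟫ = 1 := by rw [real_inner_self_eq_norm_sq, he, one_pow]
    have h2 := (abs_real_inner_le_norm _ (ι e)).trans_eq ((congrArg _ ((ι.norm_map e).trans he)).trans
      (mul_one _)) |>.trans hA
    rw [← linearProblem_step ι e 1 1]
    refine le_of_eq_of_le ?_ h2
    have hq : (linearProblem ι e 1 1).vInit = 0 := rfl
    rw [hq, sub_zero, inner_neg_left, abs_neg, InnerProductSpace.toDual_symm_apply]
    have ht₁ : (linearProblem ι e 1 1).grid N 1 = (linearProblem ι e 1 1).step N := by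
      rw [← zero_add 1, grid_succ, grid_zero, zero_add]
    simp only [linearTrajectory, sample, midTime, grid_zero, zero_add, ht₁,
      ContinuousLinearMap.comp_apply, ContinuousLinearMap.inr_apply, smul_apply, add_apply,
      linearProblem_lagDy_inr, linearProblem_lagDw, Prod.smul_fst, Prod.fst_sub, map_smul,
      inner_zero_right, ← sub_smul, smul_smul, real_inner_smul_right, ι.inner_map_map, h1,
      smul_eq_mul]
    generalize (linearProblem ι e 1 1).step N = h at hh
    congr 1
    field_simp
    ring
  have : 2 * ((α - 1 / 2) * (γ - 1 / 2)) = 0 := by linarith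
  rcases mul_eq_zero.1 ((mul_eq_zero.1 this).resolve_left two_ne_zero) with h | h
  exacts [hα (sub_eq_zero.1 h), hγ (sub_eq_zero.1 h)]

/-- Tests the control condition with constant `δu = e`. Along this trajectory control and adjoint
coincide, but the scheme samples them at times differing by `(β - γ) h`, with opposite signs at the
two nodes. The residual is exactly `h` times `(2 α - 1) (β - γ) h`, hence `K = 0`. -/
theorem not_conditionsOrder_of_control (he : ‖e‖ = 1) {α β γ : ℝ}
    (hα : α ≠ 1 / 2) (hβγ : β ≠ γ) (μ ν : Conf M)
    (hX : (linearProblem ι e 1 1).IsExactlyOptimal (linearTrajectory ι e 1 1 1 1) μ ν) :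
    ¬ (linearProblem ι e 1 1).ConditionsOrder (linearTrajectory ι e 1 1 1 1) μ ν α β γ 2 := by
  intro hcond
  obtain ⟨C, hC⟩ := hcond (fun _ => e) contDiff_const
  have hκ : (β - γ) * (2 * α - 1) = 0 := by
    refine eq_zero_of_forall_abs_le (C := C) (K := 0) fun N hN => ?_
    obtain ⟨L, hL, -, hE, -⟩ := hX N hN
    obtain ⟨-, hA, -⟩ := hC N hN L hL
    have h2 := hA 0 hN
    rw [hE 0 hN _ contDiff_const, sub_zero] at h2
    simp only [approxLHS, optimalityLHS] at h2
    rw [(hasFDerivAt_approxLagrangian_control α γ _ _ _ _).fderiv] at h2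
    have hh := step_pos (P := linearProblem ι e 1 1) hN
    have h1 : ⟪e, e⟫ = 1 := by rw [real_inner_self_eq_norm_sq, he, one_pow]
    have ht₁ : (linearProblem ι e 1 1).grid N 1 = (linearProblem ι e 1 1).step N := by
      rw [← zero_add 1, grid_succ, grid_zero, zero_add]
    simp only [linearTrajectory, sample, midTime, grid_zero, zero_add, ht₁,
      ContinuousLinearMap.comp_apply, ContinuousLinearMap.coe_fst', ContinuousLinearMap.coe_snd',
      smul_apply, add_apply, linearProblem_lagDu, Prod.snd_add, Prod.smul_snd, inner_add_left,
      real_inner_smul_left, ι.inner_map_map, h1, smul_eq_mul] at h2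
    rw [← linearProblem_step ι e 1 1]
    generalize (linearProblem ι e 1 1).step N = h at hh h2 ⊢
    refine abs_le_mul_sq_of_abs_mul_le hh (le_of_eq_of_le (congrArg _ ?_) h2)
    ring
  rcases mul_eq_zero.1 hκ with h | h
  · exact hβγ (sub_eq_zero.1 h)
  · exact hα (by linarith)

end ControlProblem

theorem mainTheorem7 (M S : ℕ) (hS : 0 < S) (hSM : S ≤ M) (α β γ : ℝ)
    (hα : α ∈ Set.Icc (0 : ℝ) 1) (hβ : β ∈ Set.Icc (0 : ℝ) 1) (hγ : γ ∈ Set.Icc (0 : ℝ) 1) :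
    ((α = 1 / 2 ∨ (β = 1 / 2 ∧ γ = 1 / 2)) →
      ∀ (P : ControlProblem M S) (X : P.Trajectory),
        P.LagrangianOrder X α β γ 2 ∧ ∀ μ ν : Conf M, P.ConditionsOrder X μ ν α β γ 2) ∧
    (¬ (α = 1 / 2 ∨ (β = 1 / 2 ∧ γ = 1 / 2)) →
      (∀ (P : ControlProblem M S) (X : P.Trajectory),
        P.LagrangianOrder X α β γ 1 ∧ ∀ μ ν : Conf M, P.ConditionsOrder X μ ν α β γ 1) ∧
      (∃ (P : ControlProblem M S) (X : P.Trajectory), ¬ P.LagrangianOrder X α β γ 2) ∧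
      (∃ (P : ControlProblem M S) (X : P.Trajectory) (μ ν : Conf M),
        P.IsExactlyOptimal X μ ν ∧ ¬ P.ConditionsOrder X μ ν α β γ 2)) := by
  refine ⟨fun hs P X => ⟨ControlProblem.lagrangianOrder X (Or.inr ⟨rfl, hs⟩), fun μ ν =>
    ControlProblem.conditionsOrder X μ ν (Or.inr ⟨rfl, hs⟩)⟩, fun hs => ?_⟩
  obtain ⟨ι⟩ := exists_linearIsometry_euclideanSpace hSM
  set e : Ctrl S := EuclideanSpace.single ⟨0, hS⟩ 1
  have he : ‖e‖ = 1 := by simp [e]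
  rw [not_or, not_and_or] at hs
  obtain ⟨hα', hβγ⟩ := hs
  refine ⟨fun P X => ⟨ControlProblem.lagrangianOrder X (Or.inl rfl), fun μ ν =>
    ControlProblem.conditionsOrder X μ ν (Or.inl rfl)⟩, ?_, ?_⟩
  -- With `d = 1/2 - γ` and `c + d - 1 = 1/2 - β` the second factor of the error coefficient becomes
  -- a sum of squares, nonzero unless `β = γ = 1/2`.
  · refine ⟨_, _, ControlProblem.not_lagrangianOrder_linearTrajectory ι e
      (3 / 2 - β - (1 / 2 - γ)) (1 / 2 - γ) he (mul_ne_zero (fun h => hα' (by linarith)) ?_)⟩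
    rw [show (1 / 2 - γ) * (1 / 2 - γ) + (1 / 2 - β) * (3 / 2 - β - (1 / 2 - γ) + (1 / 2 - γ) - 1)
      = (1 / 2 - γ) ^ 2 + (1 / 2 - β) ^ 2 by ring]
    rcases hβγ with h | h
    · exact (add_pos_of_nonneg_of_pos (sq_nonneg _) (sq_pos_iff.2 (sub_ne_zero.2 (Ne.symm h)))).ne'
    · exact (add_pos_of_pos_of_nonneg (sq_pos_iff.2 (sub_ne_zero.2 (Ne.symm h))) (sq_nonneg _)).ne'
  · have hopt := ControlProblem.isExactlyOptimal_linearTrajectory ι e 1 1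
    refine ⟨_, _, _, _, hopt, ?_⟩
    -- The velocity test is blind to `γ = 1/2`; in that case `β ≠ 1/2 = γ` and the control test
    -- applies.
    by_cases h : γ = 1 / 2
    · refine ControlProblem.not_conditionsOrder_of_control ι e he hα' (fun h' => ?_) _ _ hopt
      rcases hβγ with h1 | h1
      exacts [h1 (h'.trans h), h1 h]
    · exact ControlProblem.not_conditionsOrder_of_velocity ι e he hα' h _ _ hopt
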